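/- **Theorem.** There is a universal constant $K$ such that the following holds. Let $d,r,m$ be non-negative integers, $\epsilon>0$, $\delta\in(0,1)$, $C$ a real number, $g:\mathbb R\to\mathbb R$ a function and $f(x)=\sum_{k=0}^m c_kx^k$ a real polynomial such that $$|g(x)-f(x)|<\frac{\epsilon}{2r}\quad\text{for all }x\in[0,1],\qquad \sum_{k=0}^m|c_k|<C .$$ Let $\tilde r=\min\{r,\max\{0,\lfloor\ln(2m/\epsilon')\rfloor\}\}$ with $\epsilon'=\epsilon/(2C)$ (and $\tilde r=0$ if $m=0$) be the effective rank for estimating the traces of powers $\mathrm{Tr}(\rho^k)$, $k\le m$, of a state of rank $r$ within $\epsilon'$. Then there is an estimation procedure, consisting of finitely many non-adaptively chosen circuits, each run once on fresh copies of the input state, and a classical function of the measurement outcomes, such that for every density matrix $\rho$ on $\mathbb C^d$ of rank $r$ the output $\hat E$ satisfies $$\Pr\bigl(|\hat E-\mathrm{Tr}(g(\rho))|<\epsilon\bigr)\ge 1-\delta ,$$ and such that (with $\tilde r^j\ln^2\tilde r$ read as $0$ if $\tilde r=0$) 1. the total number of copies of $\rho$ used is at most $K\,\frac{C^2m^2\tilde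 r^4\ln^2\tilde r}{\epsilon^2}\ln\frac2\delta$ and at most $K\,\frac{C^2m^2}{\epsilon^2}\ln^6\!\bigl(2+\frac{Cm}{\epsilon}\bigr)\ln\frac2\delta$, that is, $\tilde{\mathcal O}\bigl(\frac{C^2m^2}{\epsilon^2}\ln\frac2\delta\bigr)$; 2. the number of circuit runs is at most $K\,\frac{C^2m^2\tilde r^3\ln^2\tilde r}{\epsilon^2}\ln\frac2\delta$ and at most $K\,\frac{C^2m^2}{\epsilon^2}\ln^6\!\bigl(2+\frac{Cm}{\epsilon}\bigr)\ln\frac2\delta$, that is, $\tilde{\mathcal O}\bigl(\frac{C^2m^2}{\epsilon^2}\ln\frac2\delta\bigr)$; 3. every circuit has depth at most $K$, acts on at most $K\tilde r$ wires (ancilla qubits initialised in $|0\rangle$, and $d$-dimensional registers each initialised with one copy of $\rho$; so $\mathcal O(\tilde r)$ qubits if $\rho$ is a one-qubit state and $\mathcal O(n\tilde r)$ qubits if $\rho$ is an $n$-qubit state), and contains at most $K\tilde r$ $\mathsf{CSWAP}$ operations (swaps of two registers controlled by an ancilla). The circuits consist of layers; a layer is a set of Hadamard, CNOT (on ancillas)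 and $\mathsf{CSWAP}$ gates on disjoint wires, or a computational-basis measurement of some ancillas (possibly mid-circuit), or a step of classical feedback in which Pauli $X$ is applied to ancillas according to parities of earlier outcomes. The depth is the number of layers. -/

import Mathlib

open scoped Matrix BigOperators ComplexOrder

noncomputable section

/-- A density matrix on `ℂ^d`. -/
structure IsDensity {d : ℕ} (ρ : Matrix (Fin d) (Fin d) ℂ) : Prop where
  posSemidef : ρ.PosSemidef
  trace_one : ρ.trace = 1

/-- The effective rank `min {r, ⌊ln (2k/ε)⌋}` for estimating the traces of the powers up to `k`,
of a state of rank `r`, within additive error `ε`. -/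
def effectiveRank (r k : ℕ) (ε : ℝ) : ℕ :=
  min r ⌊Real.log (2 * (k : ℝ) / ε)⌋₊

/-- The elementary gates on `a` ancilla qubits and `s` registers (each register holds one copy of
the input state): the Hadamard gate on a qubit, the CNOT gate on two qubits, and the swap of two
registers controlled by a qubit. -/
inductive Gate (a s : ℕ) : Type
  | hadamard (q : Fin a) : Gate a s
  | cnot (c t : Fin a) (h : c ≠ t) : Gate a s
  | cswap (c : Fin a) (i j : Fin s) (h : i ≠ j) : Gate a s

namespace Gate

/-- The ancilla qubits and registers a gate acts on. -/
def wires {a s : ℕ} : Gate a s → Finset (Fin a ⊕ Fin s)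
  | hadamard q => {Sum.inl q}
  | cnot c t _ => {Sum.inl c, Sum.inl t}
  | cswap c i j _ => {Sum.inl c, Sum.inr i, Sum.inr j}

/-- Whether a gate is a controlled swap. -/
def isCSwap {a s : ℕ} : Gate a s → Bool
  | hadamard _ => false
  | cnot _ _ _ => false
  | cswap _ _ _ _ => true

end Gate

/-- Labels of the computational basis of `a` qubits and `s` registers of dimension `d`. -/
abbrev BasisLabel (a s d : ℕ) : Type := (Fin a → Bool) × (Fin s → Fin d)

/-- Operators on the Hilbert space of `a` qubits and `s` registers of dimension `d`. -/
abbrev Operator (a s d : ℕ) : Type := Matrix (BasisLabel a s d) (BasisLabel a s d) ℂ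

/-- The operator that sends the basis vector `|y⟩` to `|f y⟩`. -/
def basisMap {a s d : ℕ} (f : BasisLabel a s d → BasisLabel a s d) : Operator a s d :=
  Matrix.of fun x y => if x = f y then 1 else 0

/-- The unitary of a gate. -/
def Gate.toOperator {a s : ℕ} (d : ℕ) : Gate a s → Operator a s d
  | .hadamard q => Matrix.of fun x y =>
      if x.2 = y.2 ∧ ∀ p, p ≠ q → x.1 p = y.1 p then
        (if x.1 q = true ∧ y.1 q = true then -1 else 1) / (Real.sqrt 2 : ℂ)
      else 0
  | .cnot c t _ => basisMap fun y => (Function.update y.1 t (xor (y.1 t) (y.1 c)), y.2)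
  | .cswap c i j _ => basisMap fun y =>
      (y.1, if y.1 c = true then y.2 ∘ Equiv.swap i j else y.2)

/-- One time step of a circuit: gates on pairwise disjoint wires, or a computational-basis
measurement of a set `M` of ancilla qubits, where the outcome for qubit `q` is written to the
classical bit `q`, or a step of classical feedback, where the Pauli `X` is applied to the ancilla
qubit `q` exactly if the classical bits in `S q` have odd parity. -/
inductive Layer (a s : ℕ) : Type
  | gates (l : List (Gate a s)) (h : l.Pairwise fun u v => Disjoint u.wires v.wires) : Layer a s
  | measure (M : Finset (Fin a)) : Layer a s
  | correct (S : Fin a → Finset (Fin a)) : Layer a s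

/-- The parity of the classical bits `c` over the set `T`. -/
def bitParity {a : ℕ} (c : Fin a → Bool) (T : Finset (Fin a)) : Bool :=
  decide (Odd (T.filter fun q => c q = true).card)

/-- A joint state of `a` classical bits and the quantum wires: each value of the classical bits
carries an unnormalised density operator whose trace is the probability of that value. -/
abbrev CQState (a s d : ℕ) : Type := (Fin a → Bool) → Operator a s d

/-- The projection onto the basis vectors whose qubits in `M` have the values given by `c`. -/
def projector {a s d : ℕ} (M : Finset (Fin a)) (c : Fin a → Bool) : Operator a s d :=
  Matrix.diagonal fun y => if ∀ q ∈ M, y.1 q = c q then 1 else 0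

namespace Layer

/-- The number of controlled swaps in a layer. -/
def numCSwap {a s : ℕ} : Layer a s → ℕ
  | gates l _ => l.countP Gate.isCSwap
  | measure _ => 0
  | correct _ => 0

/-- The action of a layer. A measurement overwrites the classical bits in `M`. -/
def act {a s d : ℕ} : Layer a s → CQState a s d → CQState a s d
  | gates l _, σ => fun c =>
      (l.map (Gate.toOperator d)).prod * σ c * ((l.map (Gate.toOperator d)).prod)ᴴ
  | measure M, σ => fun c =>
      projector M c * (∑ c' : Fin a → Bool with ∀ q, q ∉ M → c' q = c q, σ c') * projector M c
  | correct S, σ => fun c =>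
      basisMap (fun y => (fun q => xor (y.1 q) (bitParity c (S q)), y.2)) * σ c *
        (basisMap (fun y => (fun q => xor (y.1 q) (bitParity c (S q)), y.2)))ᴴ

end Layer

/-- A quantum circuit with mid-circuit measurement and classical feedback. -/
structure Circuit where
  /-- number of ancilla qubits, initialised in `|0⟩` -/
  ancillas : ℕ
  /-- number of registers; each is initialised with a fresh copy of the input state -/
  registers : ℕ
  /-- the time steps, first one first -/
  layers : List (Layer ancillas registers)

namespace Circuit

/-- The number of time steps, measurements and feedback steps included. -/
def depth (Q : Circuit) : ℕ := Q.layers.length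

/-- The total number of controlled swaps. -/
def numCSwap (Q : Circuit) : ℕ := (Q.layers.map Layer.numCSwap).sum

/-- The final values of the classical bits. -/
abbrev Outcome (Q : Circuit) : Type := Fin Q.ancillas → Bool

/-- All ancillas in `|0⟩`, one copy of `ρ` in every register, all classical bits zero. -/
def initial (Q : Circuit) {d : ℕ} (ρ : Matrix (Fin d) (Fin d) ℂ) :
    CQState Q.ancillas Q.registers d := fun c =>
  if c = fun _ => false then
    Matrix.of fun x y =>
      if x.1 = (fun _ => false) ∧ y.1 = (fun _ => false) then ∏ i, ρ (x.2 i) (y.2 i) else 0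
  else 0

/-- The joint state at the end of a run on copies of `ρ`. -/
def final (Q : Circuit) {d : ℕ} (ρ : Matrix (Fin d) (Fin d) ℂ) :
    CQState Q.ancillas Q.registers d :=
  Q.layers.foldl (fun σ L => L.act σ) (Q.initial ρ)

/-- The probability that a run on copies of `ρ` ends with the classical bits `c`. -/
def prob (Q : Circuit) {d : ℕ} (ρ : Matrix (Fin d) (Fin d) ℂ) (c : Q.Outcome) : ℝ :=
  (Matrix.trace (Q.final ρ c)).re

end Circuit

/-- An estimation procedure: a fixed sequence of circuits, each of which is run once on fresh
copies of the input state, and a classical function of all the outcomes. -/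
structure Procedure where
  /-- number of runs -/
  runs : ℕ
  /-- the circuit used in each run -/
  circuit : Fin runs → Circuit
  /-- the estimate computed from the outcomes -/
  estimate : (∀ i, (circuit i).Outcome) → ℝ

namespace Procedure

/-- The number of copies of the input state consumed by all runs together. -/
def copies (A : Procedure) : ℕ := ∑ i, (A.circuit i).registers

open Classical in
/-- The probability that the estimate, computed from independent runs on copies of `ρ`, is
within additive error `ε` of `v`. -/
def successProb (A : Procedure) {d : ℕ} (ρ : Matrix (Fin d) (Fin d) ℂ) (v : ℂ) (ε : ℝ) : ℝ :=
  ∑ ω : (∀ i, (A.circuit i).Outcome) with ‖((A.estimate ω : ℝ) : ℂ) - v‖ < ε,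
    ∏ i, (A.circuit i).prob ρ (ω i)

end Procedure

end

/-! If the state has spectrum `l`, then up to an error below `ε / 2` the target is an affine
function of the power sums `p_k = ∑ l_i ^ k`, `1 ≤ k ≤ m`, whose coefficients have absolute sum
below `C`. The zero eigenvalues contribute exactly `(d - r) g(0)`. So it suffices to know every
`p_k` up to `ε / (2C)`.

Low power sums determine the others. Put `E = ∏ (1 - l_i X)` and `θ f = X f'`. Then `θ E = -E P`
with `P` the generating function of the power sums. If two spectra have close power sums up to
degree `R`, the logarithmic derivative of `E' / E` has small coefficients there, hence so does `E' -
E`. Beyond `R` the coefficients of `θ E` are negligible: as `∑ l_i = 1`, the `ℓ¹` norm of `E` with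
weight `s ^ j` is at most `e ^ s`, so the tail decays like `s ^ (-R)`. If `R ≥ r`, the tail
vanishes. Thus `R = 10 q`, with `q` the effective rank, is enough (`abs_powerSum_sub_le`,
`IsSpectrum.abs_sum_pow_sub_le`). The classical step needs no recursion: any spectrum that fits the
measured power sums within the tolerance gives a valid answer (`consistentEstimate`).

Each `p_k` is the mean of a sign measured in constant depth (`cycleTest_expectation`). A cyclic
shift is a product of two reflections, and each reflection is a product of disjoint transpositions.
Each transposition gets its own ancilla, prepared and read out in the Hadamard basis. The parity
observable flips all controls, so a reflection selected by `b` always meets the one selected by `¬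
b`, and together they make the whole reflection. Hence every `b` contributes the same cyclic shift,
and no entangled control state is needed.

A Chernoff bound and a union bound over the `10 q` powers fix the number of runs
(`one_sub_le_prob_means`, `sample_size_bounds`). If the effective rank is at most `1`, a constant
output is accurate enough (`exists_constant_estimate`). -/

open PowerSeries in
/-- The weighted `ℓ¹` norm of the coefficients of `f` up to degree `n`. -/
noncomputable def truncNorm (n : ℕ) (s : ℝ) (f : PowerSeries ℝ) : ℝ :=
  ∑ j ∈ Finset.range (n + 1), |coeff j f| * s ^ j

/-! ### Stability of power sums via generating functions. -/

section PowerSums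

open PowerSeries

lemma truncNorm_nonneg {n : ℕ} {s : ℝ} (hs : 0 ≤ s) (f : PowerSeries ℝ) :
    0 ≤ truncNorm n s f :=
  Finset.sum_nonneg fun _ _ => by positivity

lemma truncNorm_add_le {n : ℕ} {s : ℝ} (hs : 0 ≤ s) (f g : PowerSeries ℝ) :
    truncNorm n s (f + g) ≤ truncNorm n s f + truncNorm n s g := by
  unfold truncNorm
  rw [← Finset.sum_add_distrib]
  refine Finset.sum_le_sum fun j _ => ?_
  rw [← add_mul, map_add]
  exact mul_le_mul_of_nonneg_right (abs_add_le _ _) (by positivity)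

lemma truncNorm_neg {n : ℕ} {s : ℝ} (f : PowerSeries ℝ) :
    truncNorm n s (-f) = truncNorm n s f := by
  simp [truncNorm]

lemma truncNorm_sub_le {n : ℕ} {s : ℝ} (hs : 0 ≤ s) (f g : PowerSeries ℝ) :
    truncNorm n s (f - g) ≤ truncNorm n s f + truncNorm n s g := by
  rw [sub_eq_add_neg, ← truncNorm_neg g]
  exact truncNorm_add_le hs _ _

/-- The antidiagonals of index at most `n` are disjoint and lie in the square `[0, n]²`, whose terms
sum to the product of the norms. -/
lemma truncNorm_mul_le {n : ℕ} {s : ℝ} (hs : 0 ≤ s) (f g : PowerSeries ℝ) :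
    truncNorm n s (f * g) ≤ truncNorm n s f * truncNorm n s g := by
  unfold truncNorm
  rw [Finset.sum_mul_sum, ← Finset.sum_product']
  calc ∑ j ∈ Finset.range (n + 1), |coeff j (f * g)| * s ^ j
      ≤ ∑ j ∈ Finset.range (n + 1), ∑ p ∈ Finset.HasAntidiagonal.antidiagonal j,
          |coeff p.1 f| * s ^ p.1 * (|coeff p.2 g| * s ^ p.2) := by
        refine Finset.sum_le_sum fun j _ => ?_
        rw [coeff_mul]
        refine (mul_le_mul_of_nonneg_right (Finset.abs_sum_le_sum_abs _ _)
          (by positivity)).trans_eq ?_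
        rw [Finset.sum_mul]
        refine Finset.sum_congr rfl fun p hp => ?_
        rw [← Finset.HasAntidiagonal.mem_antidiagonal.1 hp, abs_mul, pow_add]
        ring
    _ = ∑ p ∈ (Finset.range (n + 1)).biUnion fun j => Finset.HasAntidiagonal.antidiagonal j,
          |coeff p.1 f| * s ^ p.1 * (|coeff p.2 g| * s ^ p.2) := by
        rw [Finset.sum_biUnion]
        intro a _ b _ hab
        refine Finset.disjoint_left.2 fun p hp hq => hab ?_
        rw [← Finset.HasAntidiagonal.mem_antidiagonal.1 hp, ← Finset.HasAntidiagonal.mem_antidiagonal.1 hq]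
    _ ≤ _ := by
        refine Finset.sum_le_sum_of_subset_of_nonneg ?_ fun _ _ _ => by positivity
        intro p hp
        simp only [Finset.mem_biUnion, Finset.mem_range, Finset.HasAntidiagonal.mem_antidiagonal] at hp
        simp only [Finset.mem_product, Finset.mem_range]
        omega

/-- The Euler operator `f ↦ X f'`. -/
noncomputable def eulerOp (f : PowerSeries ℝ) : PowerSeries ℝ := X * d⁄dX ℝ f

lemma coeff_eulerOp (f : PowerSeries ℝ) (j : ℕ) : coeff j (eulerOp f) = j * coeff j f := by
  cases j with
  | zero => simp [eulerOp]
  | succ j =>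
    rw [eulerOp, coeff_succ_X_mul, coeff_derivative]
    push_cast
    ring

lemma eulerOp_mul (f g : PowerSeries ℝ) : eulerOp (f * g) = eulerOp f * g + f * eulerOp g := by
  simp only [eulerOp, Derivation.leibniz, smul_eq_mul]
  ring

lemma eulerOp_sub (f g : PowerSeries ℝ) : eulerOp (f - g) = eulerOp f - eulerOp g := by
  simp only [eulerOp, map_sub, mul_sub]

lemma eulerOp_one : eulerOp 1 = 0 := by
  ext j
  rw [coeff_eulerOp, coeff_one]
  split_ifs with h <;> simp [h]

lemma truncNorm_le_truncNorm_eulerOp {n : ℕ} {s : ℝ} (hs : 0 ≤ s) {f : PowerSeries ℝ}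
    (hf : coeff 0 f = 0) : truncNorm n s f ≤ truncNorm n s (eulerOp f) := by
  refine Finset.sum_le_sum fun j _ => mul_le_mul_of_nonneg_right ?_ (by positivity)
  rw [coeff_eulerOp, abs_mul, Nat.abs_cast]
  rcases Nat.eq_zero_or_pos j with rfl | hj
  · simp [hf]
  · exact le_mul_of_one_le_left (abs_nonneg _) (by exact_mod_cast hj)

variable {ι : Type*}

/-- The polynomial `∏ (1 - l i X)`. -/
noncomputable def elemSeries (t : Finset ι) (l : ι → ℝ) : PowerSeries ℝ :=
  ∏ i ∈ t, (1 - C (l i) * X)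

/-- The generating function of the complete homogeneous polynomials. -/
noncomputable def completeSeries (t : Finset ι) (l : ι → ℝ) : PowerSeries ℝ :=
  ∏ i ∈ t, PowerSeries.mk fun n => l i ^ n

/-- The generating function of the power sums of positive degree. -/
noncomputable def powerSumSeries (t : Finset ι) (l : ι → ℝ) : PowerSeries ℝ :=
  ∑ i ∈ t, PowerSeries.mk fun n => if n = 0 then 0 else l i ^ n

lemma coeff_powerSumSeries (t : Finset ι) (l : ι → ℝ) (n : ℕ) :
    coeff n (powerSumSeries t l) = if n = 0 then 0 else ∑ i ∈ t, l i ^ n := by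
  simp only [powerSumSeries, map_sum, coeff_mk]
  split_ifs <;> simp

lemma one_sub_mul_geom (a : ℝ) :
    (1 - C a * X) * (PowerSeries.mk fun n => a ^ n) = 1 := by
  ext n
  cases n with
  | zero => simp [sub_mul, mul_assoc]
  | succ n =>
    rw [sub_mul, one_mul, mul_assoc, map_sub, coeff_C_mul, coeff_succ_X_mul, coeff_mk, coeff_mk,
      coeff_one, pow_succ]
    simp
    ring

lemma one_sub_mul_shifted_geom (a : ℝ) :
    (1 - C a * X) * (PowerSeries.mk fun n => if n = 0 then 0 else a ^ n) = C a * X := by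
  have h : (PowerSeries.mk fun n => if n = 0 then 0 else a ^ n)
      = C a * X * PowerSeries.mk fun n => a ^ n := by
    ext n
    cases n with
    | zero => simp [mul_assoc]
    | succ n => rw [mul_assoc, coeff_C_mul, coeff_succ_X_mul]; simp [pow_succ, mul_comm]
  rw [h, mul_left_comm, one_sub_mul_geom, mul_one]

lemma elemSeries_mul_completeSeries (t : Finset ι) (l : ι → ℝ) :
    elemSeries t l * completeSeries t l = 1 := by
  rw [elemSeries, completeSeries, ← Finset.prod_mul_distrib]
  exact Finset.prod_eq_one fun i _ => one_sub_mul_geom (l i)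

lemma eulerOp_linear (a : ℝ) : eulerOp (1 - C a * X) = -(C a * X) := by
  rw [eulerOp_sub, eulerOp_one, zero_sub, neg_inj]
  ext n
  rw [coeff_eulerOp, coeff_C_mul, coeff_X]
  split_ifs with h <;> simp [h]

/-- Newton's identities: the logarithmic derivative of `1 - aX` is minus the geometric series
without its constant term, and logarithmic derivatives add up over a product. -/
lemma elemSeries_mul_powerSumSeries (t : Finset ι) (l : ι → ℝ) :
    elemSeries t l * powerSumSeries t l = -eulerOp (elemSeries t l) := by
  classical
  induction t using Finset.induction_on with
  | empty => simp [elemSeries, powerSumSeries, eulerOp_one]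
  | insert a t ha ih =>
    have h1 : elemSeries (insert a t) l = (1 - C (l a) * X) * elemSeries t l :=
      Finset.prod_insert ha
    have h2 : powerSumSeries (insert a t) l
        = (PowerSeries.mk fun n => if n = 0 then 0 else l a ^ n) + powerSumSeries t l :=
      Finset.sum_insert ha
    rw [h1, h2, eulerOp_mul, eulerOp_linear]
    linear_combination elemSeries t l * one_sub_mul_shifted_geom (l a)
      + (1 - C (l a) * X) * ih

/-- The complete homogeneous polynomial has the monomials of `(∑ l_i) ^ n`, with coefficients `1` in
place of multinomial coefficients. -/
lemma coeff_completeSeries_mem (t : Finset ι) {l : ι → ℝ} (hl : ∀ i ∈ t, 0 ≤ l i) (n : ℕ) :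
    0 ≤ coeff n (completeSeries t l) ∧
      coeff n (completeSeries t l) ≤ (∑ i ∈ t, l i) ^ n := by
  classical
  induction t using Finset.induction_on generalizing n with
  | empty =>
    simp only [completeSeries, Finset.prod_empty, coeff_one, Finset.sum_empty]
    split_ifs with h <;> simp [h]
  | insert a t ha ih =>
    have ih := ih fun i hi => hl i (Finset.mem_insert_of_mem hi)
    have ha0 := hl a (Finset.mem_insert_self a t)
    have hS : 0 ≤ ∑ i ∈ t, l i :=
      Finset.sum_nonneg fun i hi => hl i (Finset.mem_insert_of_mem hi)
    have h1 : completeSeries (insert a t) l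
        = (PowerSeries.mk fun n => l a ^ n) * completeSeries t l := Finset.prod_insert ha
    rw [h1, coeff_mul, Finset.sum_insert ha]
    constructor
    · refine Finset.sum_nonneg fun p _ => ?_
      rw [coeff_mk]
      exact mul_nonneg (pow_nonneg ha0 _) (ih _).1
    · rw [add_pow, Finset.Nat.sum_antidiagonal_eq_sum_range_succ_mk]
      refine Finset.sum_le_sum fun k hk => ?_
      have hc : (1 : ℝ) ≤ n.choose k := by
        exact_mod_cast Nat.choose_pos (Nat.lt_succ_iff.1 (Finset.mem_range.1 hk))
      rw [coeff_mk]
      calc l a ^ k * coeff (n - k) (completeSeries t l)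
          ≤ l a ^ k * (∑ i ∈ t, l i) ^ (n - k) :=
            mul_le_mul_of_nonneg_left (ih _).2 (pow_nonneg ha0 _)
        _ ≤ _ := le_mul_of_one_le_right (by positivity) hc

lemma truncNorm_one {n : ℕ} {s : ℝ} : truncNorm n s 1 = 1 := by
  simp only [truncNorm, coeff_one]
  rw [Finset.sum_eq_single 0] <;> simp +contextual

lemma truncNorm_C_mul_X_le {n : ℕ} {s a : ℝ} (hs : 0 ≤ s) (ha : 0 ≤ a) :
    truncNorm n s (C a * X) ≤ a * s := by
  simp only [truncNorm, coeff_C_mul, coeff_X]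
  rw [Finset.sum_congr rfl (g := fun j => if j = 1 then a * s else 0)]
  · rw [Finset.sum_ite_eq']
    split_ifs
    · exact le_rfl
    · positivity
  · intro j _
    split_ifs with h <;> simp [h, abs_of_nonneg ha]

/-- Each factor has norm at most `1 + s l_i ≤ exp (s l_i)`, so the bounds depend on the sum of the
`l_i` and not on their number. The second bound follows by the Leibniz rule. -/
lemma truncNorm_elemSeries_le (t : Finset ι) {l : ι → ℝ} (hl : ∀ i ∈ t, 0 ≤ l i) {n : ℕ} {s : ℝ}
    (hs : 0 ≤ s) :
    truncNorm n s (elemSeries t l) ≤ Real.exp (s * ∑ i ∈ t, l i) ∧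
      truncNorm n s (eulerOp (elemSeries t l))
        ≤ s * (∑ i ∈ t, l i) * Real.exp (s * ∑ i ∈ t, l i) := by
  classical
  induction t using Finset.induction_on with
  | empty =>
    have h : truncNorm n s 0 = 0 := by simp [truncNorm]
    simp [elemSeries, eulerOp_one, truncNorm_one, h]
  | insert a t ha ih =>
    have ih := ih fun i hi => hl i (Finset.mem_insert_of_mem hi)
    have ha0 := hl a (Finset.mem_insert_self a t)
    have hS : 0 ≤ ∑ i ∈ t, l i :=
      Finset.sum_nonneg fun i hi => hl i (Finset.mem_insert_of_mem hi)
    have h1 : elemSeries (insert a t) l = (1 - C (l a) * X) * elemSeries t l :=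
      Finset.prod_insert ha
    rw [h1, Finset.sum_insert ha, eulerOp_mul, eulerOp_linear]
    set S := ∑ i ∈ t, l i
    have h2 : truncNorm n s (1 - C (l a) * X) ≤ Real.exp (s * l a) := by
      refine (truncNorm_sub_le hs _ _).trans ?_
      have := truncNorm_C_mul_X_le (n := n) hs ha0
      have := Real.add_one_le_exp (s * l a)
      rw [truncNorm_one]
      linarith
    have h3 : Real.exp (s * (l a + S)) = Real.exp (s * l a) * Real.exp (s * S) := by
      rw [← Real.exp_add]; ring_nf
    have h4 : (1 : ℝ) ≤ Real.exp (s * l a) := Real.one_le_exp (by positivity)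
    constructor
    · rw [h3]
      exact (truncNorm_mul_le hs _ _).trans
        (mul_le_mul h2 ih.1 (truncNorm_nonneg hs _) (Real.exp_nonneg _))
    · refine (truncNorm_add_le hs _ _).trans ?_
      have h5 : truncNorm n s (-(C (l a) * X) * elemSeries t l)
          ≤ l a * s * Real.exp (s * S) := by
        refine (truncNorm_mul_le hs _ _).trans
          (mul_le_mul ?_ ih.1 (truncNorm_nonneg hs _) (by positivity))
        rw [truncNorm_neg]
        exact truncNorm_C_mul_X_le hs ha0
      have h6 : truncNorm n s ((1 - C (l a) * X) * eulerOp (elemSeries t l))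
          ≤ Real.exp (s * l a) * (s * S * Real.exp (s * S)) :=
        (truncNorm_mul_le hs _ _).trans
          (mul_le_mul h2 ih.2 (truncNorm_nonneg hs _) (Real.exp_nonneg _))
      have h7 : l a * s * Real.exp (s * S)
          ≤ Real.exp (s * l a) * (l a * s * Real.exp (s * S)) :=
        le_mul_of_one_le_left (by positivity) h4
      rw [h3]
      linarith

lemma coeff_elemSeries_eq_zero (t : Finset ι) (l : ι → ℝ) {j : ℕ} (hj : t.card < j) :
    coeff j (elemSeries t l) = 0 := by
  classical
  induction t using Finset.induction_on generalizing j with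
  | empty =>
    have : j ≠ 0 := by simp at hj; omega
    simp [elemSeries, coeff_one, this]
  | insert a t ha ih =>
    have h1 : elemSeries (insert a t) l = (1 - C (l a) * X) * elemSeries t l :=
      Finset.prod_insert ha
    rw [Finset.card_insert_of_notMem ha] at hj
    obtain ⟨j, rfl⟩ : ∃ i, j = i + 1 := ⟨j - 1, by omega⟩
    rw [h1, sub_mul, one_mul, mul_assoc, map_sub, coeff_C_mul, coeff_succ_X_mul,
      ih (by omega), ih (by omega)]
    simp

/-- A coefficient of degree above `R` carries weight at least `s ^ R` in the weighted norm. The free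
parameter `s` makes the tail exponentially small in `R`. -/
lemma sum_tail_elemSeries_le (t : Finset ι) {l : ι → ℝ} (hl : ∀ i ∈ t, 0 ≤ l i)
    (hsum : ∑ i ∈ t, l i = 1) (R k : ℕ) {s : ℝ} (hs : 1 ≤ s) :
    ∑ j ∈ Finset.Ioc R k, |coeff j (eulerOp (elemSeries t l))| ≤ s * Real.exp s / s ^ R := by
  have h := (truncNorm_elemSeries_le t hl (n := k) (s := s) (by linarith)).2
  rw [hsum, mul_one] at h
  rw [le_div_iff₀ (by positivity), Finset.sum_mul]
  refine le_trans ?_ h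
  refine (Finset.sum_le_sum (g := fun j => |coeff j (eulerOp (elemSeries t l))| * s ^ j)
    fun j hj => ?_).trans ?_
  · exact mul_le_mul_of_nonneg_left (pow_le_pow_right₀ hs (Finset.mem_Ioc.1 hj).1.le)
      (abs_nonneg _)
  · refine Finset.sum_le_sum_of_subset_of_nonneg ?_ fun _ _ _ => by positivity
    intro j hj
    have := Finset.mem_Ioc.1 hj
    exact Finset.mem_range.2 (by omega)

lemma eulerOp_completeSeries (t : Finset ι) (l : ι → ℝ) :
    eulerOp (completeSeries t l) = completeSeries t l * powerSumSeries t l := by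
  have h1 := elemSeries_mul_completeSeries t l
  have h2 := congrArg eulerOp h1
  rw [eulerOp_mul, eulerOp_one] at h2
  have h3 := elemSeries_mul_powerSumSeries t l
  linear_combination completeSeries t l * h2 - eulerOp (completeSeries t l) * h1
    - completeSeries t l ^ 2 * h3 + completeSeries t l * powerSumSeries t l * h1

/-- If `θ Q = Q D` and the coefficients of `D` up to degree `R` are small, so are those of
`θ Q`. -/
lemma truncNorm_eulerOp_le_of_eq_mul {Q D : PowerSeries ℝ} (hQ : eulerOp Q = Q * D)
    (hQ0 : coeff 0 Q = 1) (hD0 : coeff 0 D = 0) {R : ℕ} {η : ℝ} (hη : 0 ≤ η)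
    (hD : ∀ j ≤ R, |coeff j D| ≤ η) (hR : η * R ≤ 1 / 2) :
    truncNorm R 1 (eulerOp Q) ≤ 2 * η * R := by
  -- Since `D` has no constant term, the coefficient of degree `j + 1` in `Q D` involves only
  -- earlier coefficients of `Q`.
  have step : ∀ j, j + 1 ≤ R →
      |coeff (j + 1) (eulerOp Q)| ≤ η * ∑ i ∈ Finset.range (j + 1), |coeff i Q| := by
    intro j hj
    rw [hQ, coeff_mul, Finset.Nat.sum_antidiagonal_eq_sum_range_succ_mk, Finset.sum_range_succ]
    simp only [Nat.sub_self, hD0, mul_zero, add_zero]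
    refine (Finset.abs_sum_le_sum_abs _ _).trans ?_
    rw [Finset.mul_sum]
    refine Finset.sum_le_sum fun i _ => ?_
    rw [abs_mul, mul_comm]
    exact mul_le_mul_of_nonneg_right (hD _ (by omega)) (abs_nonneg _)
  -- A discrete Grönwall argument: each new coefficient is at most `η` times the partial sum so far.
  have bound : ∀ j ≤ R, ∑ i ∈ Finset.range (j + 1), |coeff i Q| ≤ (1 + η) ^ j := by
    intro j
    induction j with
    | zero => intro _; simp [hQ0]
    | succ j ih =>
      intro hj
      have ih := ih (by omega)
      have h1 := step j hj
      rw [coeff_eulerOp, abs_mul, Nat.abs_cast] at h1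
      have h2 : |coeff (j + 1) Q| ≤ ((j + 1 : ℕ) : ℝ) * |coeff (j + 1) Q| :=
        le_mul_of_one_le_left (abs_nonneg _) (by push_cast; linarith [Nat.cast_nonneg (α := ℝ) j])
      rw [Finset.sum_range_succ, pow_succ]
      nlinarith
  have two : ∀ j ≤ R, ∑ i ∈ Finset.range (j + 1), |coeff i Q| ≤ 2 := by
    intro j hj
    refine (bound j hj).trans ?_
    calc (1 + η) ^ j ≤ (1 + η) ^ R := pow_le_pow_right₀ (by linarith) hj
      _ ≤ Real.exp η ^ R := by
          refine pow_le_pow_left₀ (by linarith) ?_ _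
          linarith [Real.add_one_le_exp η]
      _ = Real.exp (η * R) := by rw [← Real.exp_nat_mul]; ring_nf
      _ ≤ Real.exp (1 / 2) := Real.exp_le_exp.2 hR
      _ ≤ 2 := by
          have h : Real.exp (1 / 2) ^ 2 = Real.exp 1 := by
            rw [← Real.exp_nat_mul]; norm_num
          have := Real.exp_one_lt_d9
          nlinarith [Real.exp_pos (1 / 2)]
  unfold truncNorm
  rw [Finset.sum_range_succ']
  simp only [one_pow, mul_one]
  rw [coeff_eulerOp Q 0]
  simp only [Nat.cast_zero, zero_mul, abs_zero, add_zero]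
  refine (Finset.sum_le_card_nsmul _ _ (η * 2) fun j hj => ?_).trans_eq ?_
  · have hj := Finset.mem_range.1 hj
    exact (step j hj).trans (mul_le_mul_of_nonneg_left (two j hj.le) hη)
  · rw [Finset.card_range, nsmul_eq_mul]; ring

lemma coeff_zero_elemSeries (t : Finset ι) (l : ι → ℝ) : coeff 0 (elemSeries t l) = 1 := by
  simp [elemSeries, map_prod]

lemma coeff_zero_completeSeries (t : Finset ι) (l : ι → ℝ) :
    coeff 0 (completeSeries t l) = 1 := by
  have h := congrArg (coeff 0) (elemSeries_mul_completeSeries t l)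
  simpa [coeff_zero_elemSeries, -coeff_zero_eq_constantCoeff, coeff_mul] using h

/-- The quotient `Q = E' / E = E' H` has logarithmic derivative `P - P'`, which is small up to
degree `R`; so `Q - 1` and `θ Q` are small. Then `E' - E = E (Q - 1)` and the Leibniz rule give two
terms of size `e · 2 η R`. -/
lemma truncNorm_eulerOp_elemSeries_sub_le (t t' : Finset ι) {l l' : ι → ℝ}
    (hl : ∀ i ∈ t, 0 ≤ l i) (hsum : ∑ i ∈ t, l i = 1) {R : ℕ} {η : ℝ} (hη : 0 ≤ η)
    (hR : η * R ≤ 1 / 2)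
    (hp : ∀ j, 1 ≤ j → j ≤ R → |∑ i ∈ t, l i ^ j - ∑ i ∈ t', l' i ^ j| ≤ η) :
    truncNorm R 1 (eulerOp (elemSeries t' l' - elemSeries t l))
      ≤ 4 * Real.exp 1 * (η * R) := by
  set E := elemSeries t l
  set E' := elemSeries t' l'
  set H := completeSeries t l
  set P := powerSumSeries t l
  set P' := powerSumSeries t' l'
  have hEH : E * H = 1 := elemSeries_mul_completeSeries t l
  have hQ : eulerOp (E' * H) = E' * H * (P - P') := by
    rw [eulerOp_mul, eulerOp_completeSeries]
    have := elemSeries_mul_powerSumSeries t' l'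
    linear_combination H * this
  have hQ0 : coeff 0 (E' * H) = 1 := by
    rw [coeff_mul]
    simp [-coeff_zero_eq_constantCoeff, E', H, coeff_zero_elemSeries, coeff_zero_completeSeries]
  have hD0 : coeff 0 (P - P') = 0 := by
    rw [map_sub, coeff_powerSumSeries, coeff_powerSumSeries]; simp
  have hD : ∀ j ≤ R, |coeff j (P - P')| ≤ η := by
    intro j hj
    rcases Nat.eq_zero_or_pos j with rfl | h0
    · rw [hD0, abs_zero]; exact hη
    · rw [map_sub, coeff_powerSumSeries, coeff_powerSumSeries, if_neg h0.ne', if_neg h0.ne']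
      exact hp j h0 hj
  have key := truncNorm_eulerOp_le_of_eq_mul hQ hQ0 hD0 hη hD hR
  have hθ1 : eulerOp (E' * H - 1) = eulerOp (E' * H) := by
    rw [eulerOp_sub, eulerOp_one, sub_zero]
  have key2 : truncNorm R 1 (E' * H - 1) ≤ 2 * η * R := by
    rw [← hθ1] at key
    refine (truncNorm_le_truncNorm_eulerOp zero_le_one ?_).trans key
    rw [map_sub, hQ0, coeff_zero_one, sub_self]
  have hΔ : E' - E = E * (E' * H - 1) := by linear_combination -E' * hEH
  rw [hΔ, eulerOp_mul, hθ1]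
  obtain ⟨h1, h2⟩ := truncNorm_elemSeries_le t hl (n := R) zero_le_one
  rw [hsum, mul_one] at h1 h2
  rw [one_mul] at h2
  refine (truncNorm_add_le zero_le_one _ _).trans ?_
  have h3 := (truncNorm_mul_le (n := R) zero_le_one (eulerOp E) (E' * H - 1)).trans
    (mul_le_mul h2 key2 (truncNorm_nonneg zero_le_one _) (Real.exp_nonneg _))
  have h4 := (truncNorm_mul_le (n := R) zero_le_one E (eulerOp (E' * H))).trans
    (mul_le_mul h1 key (truncNorm_nonneg zero_le_one _) (Real.exp_nonneg _))
  linarith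

/-- Stability of the power sums of a probability vector: the power sum of degree `k` is determined
by those of degree at most `R`, up to the tails of the elementary symmetric functions. -/
theorem abs_powerSum_sub_le (t t' : Finset ι) {l l' : ι → ℝ}
    (hl : ∀ i ∈ t, 0 ≤ l i) (hsum : ∑ i ∈ t, l i = 1)
    (hl' : ∀ i ∈ t', 0 ≤ l' i) (hsum' : ∑ i ∈ t', l' i = 1)
    {R k : ℕ} {η τ : ℝ} (hη : 0 ≤ η) (hR : η * R ≤ 1 / 2) (hk : 1 ≤ k)
    (hp : ∀ j, 1 ≤ j → j ≤ R → |∑ i ∈ t, l i ^ j - ∑ i ∈ t', l' i ^ j| ≤ η)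
    (hτ : ∑ j ∈ Finset.Ioc R k, |coeff j (eulerOp (elemSeries t l))| ≤ τ)
    (hτ' : ∑ j ∈ Finset.Ioc R k, |coeff j (eulerOp (elemSeries t' l'))| ≤ τ) :
    |∑ i ∈ t, l i ^ k - ∑ i ∈ t', l' i ^ k|
      ≤ 2 * Real.exp 1 * k * (4 * Real.exp 1 * (η * R) + 2 * τ) := by
  have hN := truncNorm_eulerOp_elemSeries_sub_le t t' hl hsum hη hR hp
  obtain ⟨h1, h2⟩ := truncNorm_elemSeries_le t hl (n := k) zero_le_one
  rw [hsum, mul_one] at h1 h2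
  rw [one_mul] at h2
  have c1 := fun n => coeff_completeSeries_mem t hl n
  have c2 := fun n => coeff_completeSeries_mem t' hl' n
  simp only [hsum, hsum', one_pow] at c1 c2
  have e1 := elemSeries_mul_powerSumSeries t l
  have e2 := elemSeries_mul_powerSumSeries t' l'
  have i1 := elemSeries_mul_completeSeries t l
  have i2 := elemSeries_mul_completeSeries t' l'
  have hD : coeff k (powerSumSeries t l - powerSumSeries t' l')
      = ∑ i ∈ t, l i ^ k - ∑ i ∈ t', l' i ^ k := by
    rw [map_sub, coeff_powerSumSeries, coeff_powerSumSeries, if_neg (by omega), if_neg (by omega)]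
  rw [← hD]
  have z1 := coeff_zero_elemSeries t l
  have z2 := coeff_zero_elemSeries t' l'
  set E := elemSeries t l
  set E' := elemSeries t' l'
  set H := completeSeries t l
  set H' := completeSeries t' l'
  set P := powerSumSeries t l
  set P' := powerSumSeries t' l'
  set Δ := E' - E
  -- This Wronskian equals `E E' (P - P')`, so `P - P' = W H H'`: the difference is linear in the
  -- small series `Δ` and `θ Δ`.
  set W := E * eulerOp Δ - Δ * eulerOp E
  have hΔ0 : coeff 0 Δ = 0 := by rw [map_sub, z1, z2, sub_self]
  have hθΔ : truncNorm k 1 (eulerOp Δ) ≤ 4 * Real.exp 1 * (η * R) + 2 * τ := by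
    have hsplit : truncNorm k 1 (eulerOp Δ) ≤ truncNorm R 1 (eulerOp Δ)
        + ∑ j ∈ Finset.Ioc R k, |coeff j (eulerOp Δ)| := by
      simp only [truncNorm, one_pow, mul_one]
      rw [← Finset.sum_union]
      · refine Finset.sum_le_sum_of_subset_of_nonneg ?_ fun _ _ _ => abs_nonneg _
        intro j hj
        simp only [Finset.mem_union, Finset.mem_range, Finset.mem_Ioc] at hj ⊢
        omega
      · refine Finset.disjoint_left.2 fun j h h' => ?_
        simp only [Finset.mem_range, Finset.mem_Ioc] at h h'
        omega
    have htail : ∑ j ∈ Finset.Ioc R k, |coeff j (eulerOp Δ)| ≤ τ + τ := by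
      refine le_trans ?_ (add_le_add hτ' hτ)
      rw [← Finset.sum_add_distrib]
      refine Finset.sum_le_sum fun j _ => ?_
      rw [eulerOp_sub, map_sub]
      exact abs_sub _ _
    linarith
  have hΔ : truncNorm k 1 Δ ≤ 4 * Real.exp 1 * (η * R) + 2 * τ :=
    (truncNorm_le_truncNorm_eulerOp zero_le_one hΔ0).trans hθΔ
  have hW : truncNorm k 1 W ≤ 2 * Real.exp 1 * (4 * Real.exp 1 * (η * R) + 2 * τ) := by
    refine (truncNorm_sub_le zero_le_one _ _).trans ?_
    have h3 := (truncNorm_mul_le (n := k) zero_le_one E (eulerOp Δ)).trans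
      (mul_le_mul h1 hθΔ (truncNorm_nonneg zero_le_one _) (Real.exp_nonneg _))
    have h4 := (truncNorm_mul_le (n := k) zero_le_one Δ (eulerOp E)).trans
      (mul_le_mul hΔ h2 (truncNorm_nonneg zero_le_one _)
        ((truncNorm_nonneg zero_le_one _).trans hΔ))
    linarith
  have hDW : P - P' = W * (H * H') := by
    have hEE : E * E' * (P - P') = W := by
      linear_combination E' * e1 - E * e2 - E * eulerOp_sub E' E
    rw [← hEE]
    linear_combination (-(P - P')) * (E' * H') * i1 - (P - P') * i2
  -- The vanishing constant term leaves only coefficients of `H H'` of degree at most `k - 1`, which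
  -- gives the factor `k` instead of `k + 1`.
  have hW0 : coeff 0 W = 0 := by
    rw [map_sub, coeff_mul, coeff_mul]
    simp [-coeff_zero_eq_constantCoeff, coeff_eulerOp]
  have hHH : ∀ n, |coeff n (H * H')| ≤ n + 1 := by
    intro n
    rw [coeff_mul]
    refine (Finset.abs_sum_le_sum_abs _ _).trans ?_
    refine (Finset.sum_le_card_nsmul _ _ 1 fun p _ => ?_).trans_eq ?_
    · rw [abs_mul, abs_of_nonneg (c1 _).1, abs_of_nonneg (c2 _).1]
      exact mul_le_one₀ (c1 _).2 (c2 _).1 (c2 _).2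
    · simp
  have hk' : |coeff k (P - P')| ≤ k * truncNorm k 1 W := by
    rw [hDW, coeff_mul, Finset.Nat.sum_antidiagonal_eq_sum_range_succ_mk]
    refine (Finset.abs_sum_le_sum_abs _ _).trans ?_
    rw [truncNorm, Finset.mul_sum]
    refine Finset.sum_le_sum fun j hj => ?_
    simp only [one_pow, mul_one, abs_mul]
    rcases Nat.eq_zero_or_pos j with rfl | h0
    · simp [-coeff_zero_eq_constantCoeff, hW0]
    · rw [mul_comm]
      refine mul_le_mul_of_nonneg_right ((hHH _).trans ?_) (abs_nonneg _)
      have := Finset.mem_range.1 hj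
      exact_mod_cast (by omega : k - j + 1 ≤ k)
  refine hk'.trans ((mul_le_mul_of_nonneg_left hW (Nat.cast_nonneg k)).trans_eq ?_)
  ring

end PowerSums

/-! ### Chernoff and union bounds on a finite product space. -/

section Concentration

lemma sum_prod_pi {I : Type*} [Fintype I] [DecidableEq I] {Ω : I → Type*} [∀ i, Fintype (Ω i)]
    (F : ∀ i, Ω i → ℝ) : ∑ ω : (∀ i, Ω i), ∏ i, F i (ω i) = ∏ i, ∑ x, F i x := by
  rw [Finset.prod_univ_sum, Fintype.piFinset_univ]

/-- The moment generating function of a centred variable that is bounded by `2`. -/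
lemma sum_mul_exp_le {Ω : Type*} [Fintype Ω] {p Y : Ω → ℝ} (hp : ∀ x, 0 ≤ p x)
    (hp1 : ∑ x, p x = 1) (hY : ∀ x, |Y x| ≤ 2) (hmean : ∑ x, p x * Y x = 0) {u : ℝ}
    (hu : |u| ≤ 1 / 2) : ∑ x, p x * Real.exp (u * Y x) ≤ Real.exp (4 * u ^ 2) := by
  have h : ∀ x, p x * Real.exp (u * Y x) ≤ p x + u * (p x * Y x) + p x * (4 * u ^ 2) := by
    intro x
    -- On `[-1, 1]` one has `exp z ≤ 1 + z + z ^ 2`; the linear term vanishes in the mean.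
    have h1 : |u * Y x| ≤ 1 := by
      rw [abs_mul]
      have := mul_le_mul hu (hY x) (abs_nonneg _) (by norm_num)
      linarith
    have h2 := (abs_le.1 (Real.abs_exp_sub_one_sub_id_le h1)).2
    have h3 : (Y x) ^ 2 ≤ 4 := by
      have := abs_le.1 (hY x)
      nlinarith
    have h4 : (u * Y x) ^ 2 ≤ 4 * u ^ 2 := by
      rw [mul_pow]; nlinarith [sq_nonneg u]
    have h5 : Real.exp (u * Y x) ≤ 1 + u * Y x + 4 * u ^ 2 := by linarith
    have := mul_le_mul_of_nonneg_left h5 (hp x)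
    linarith
  refine (Finset.sum_le_sum fun x _ => h x).trans ?_
  rw [Finset.sum_add_distrib, Finset.sum_add_distrib, ← Finset.mul_sum, ← Finset.sum_mul, hmean,
    hp1]
  linarith [Real.add_one_le_exp (4 * u ^ 2)]

lemma prob_sum_ge_le {I : Type*} [Fintype I] [DecidableEq I] {Ω : I → Type*} [∀ i, Fintype (Ω i)]
    {p Y : ∀ i, Ω i → ℝ} (hp : ∀ i x, 0 ≤ p i x) (hp1 : ∀ i, ∑ x, p i x = 1)
    (hY : ∀ i x, |Y i x| ≤ 2) (hmean : ∀ i, ∑ x, p i x * Y i x = 0) (S : Finset I) {η : ℝ}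
    (hη : 0 ≤ η) (hη4 : η ≤ 4) :
    (∑ ω : (∀ i, Ω i), if η * S.card ≤ ∑ i ∈ S, Y i (ω i) then ∏ i, p i (ω i) else 0)
      ≤ Real.exp (-(S.card * η ^ 2 / 16)) := by
  -- The minimiser of `-u η + 4 u ^ 2`, with value `-η ^ 2 / 16`. The assumption `η ≤ 4` keeps `u ≤
  -- 1 / 2`.
  set u := η / 8 with hu
  have hu2 : |u| ≤ 1 / 2 := by rw [abs_of_nonneg (by positivity)]; linarith
  have h1 : ∀ ω : (∀ i, Ω i), (if η * S.card ≤ ∑ i ∈ S, Y i (ω i) then ∏ i, p i (ω i) else 0)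
      ≤ Real.exp (-(u * (η * S.card)))
        * ∏ i, (p i (ω i) * if i ∈ S then Real.exp (u * Y i (ω i)) else 1) := by
    intro ω
    have hpos : 0 ≤ ∏ i, p i (ω i) := Finset.prod_nonneg fun i _ => hp i _
    rw [Finset.prod_mul_distrib, Finset.prod_ite_mem, Finset.univ_inter, ← Real.exp_sum,
      ← Finset.mul_sum, mul_left_comm, ← Real.exp_add]
    split_ifs with h
    · refine le_mul_of_one_le_right hpos (Real.one_le_exp ?_)
      have := mul_le_mul_of_nonneg_left h (show 0 ≤ u by positivity)
      linarith
    · positivity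
  refine (Finset.sum_le_sum fun ω _ => h1 ω).trans ?_
  rw [← Finset.mul_sum,
    sum_prod_pi fun i x => p i x * if i ∈ S then Real.exp (u * Y i x) else 1]
  have h2 : ∏ i, ∑ x, (p i x * if i ∈ S then Real.exp (u * Y i x) else 1)
      ≤ ∏ i, if i ∈ S then Real.exp (4 * u ^ 2) else 1 := by
    refine Finset.prod_le_prod (fun i _ => Finset.sum_nonneg fun x _ => ?_) fun i _ => ?_
    · have := hp i x
      split_ifs <;> positivity
    · split_ifs with h
      · exact sum_mul_exp_le (hp i) (hp1 i) (hY i) (hmean i) hu2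
      · simp [hp1]
  refine (mul_le_mul_of_nonneg_left h2 (Real.exp_nonneg _)).trans_eq ?_
  rw [Finset.prod_ite_mem, Finset.univ_inter, Finset.prod_const, ← Real.exp_nat_mul,
    ← Real.exp_add]
  congr 1
  rw [hu]
  ring

/-- The union bound over several empirical means of bounded independent variables. -/
theorem one_sub_le_prob_means {I : Type*} [Fintype I] [DecidableEq I] {Ω : I → Type*}
    [∀ i, Fintype (Ω i)] {T : Type*} [Fintype T] {p Z : ∀ i, Ω i → ℝ} {μ : T → ℝ}
    (hp : ∀ i x, 0 ≤ p i x) (hp1 : ∀ i, ∑ x, p i x = 1) (hZ : ∀ i x, |Z i x| ≤ 1)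
    (S : T → Finset I) (hmean : ∀ t, ∀ i ∈ S t, ∑ x, p i x * Z i x = μ t) {N : ℕ} (hN : 0 < N)
    (hS : ∀ t, (S t).card = N) {η : ℝ} (hη : 0 ≤ η) (hη4 : η ≤ 4)
    (G : (∀ i, Ω i) → Prop) [DecidablePred G]
    (hG : ∀ ω, (∀ t, |(∑ i ∈ S t, Z i (ω i)) / N - μ t| ≤ η) → G ω) :
    1 - Fintype.card T * (2 * Real.exp (-(N * η ^ 2 / 16)))
      ≤ ∑ ω : (∀ i, Ω i) with G ω, ∏ i, p i (ω i) := by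
  have hN' : (0 : ℝ) < N := by exact_mod_cast hN
  set m : I → ℝ := fun i => ∑ x, p i x * Z i x with hm
  have hm1 : ∀ i, |m i| ≤ 1 := by
    intro i
    refine (Finset.abs_sum_le_sum_abs _ _).trans ?_
    rw [← hp1 i]
    refine Finset.sum_le_sum fun x _ => ?_
    rw [abs_mul, abs_of_nonneg (hp i x)]
    exact mul_le_of_le_one_right (hp i x) (hZ i x)
  have up := fun t => prob_sum_ge_le (Y := fun i x => Z i x - m i) hp hp1
    (fun i x => (abs_sub _ _).trans (by linarith [hZ i x, hm1 i]))
    (fun i => by simp only [mul_sub, Finset.sum_sub_distrib, ← Finset.sum_mul, hp1]; simp [hm])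
    (S t) hη hη4
  have lo := fun t => prob_sum_ge_le (Y := fun i x => m i - Z i x) hp hp1
    (fun i x => (abs_sub _ _).trans (by linarith [hZ i x, hm1 i]))
    (fun i => by simp only [mul_sub, Finset.sum_sub_distrib, ← Finset.sum_mul, hp1]; simp [hm])
    (S t) hη hη4
  have total : ∑ ω : (∀ i, Ω i), ∏ i, p i (ω i) = 1 := by
    rw [sum_prod_pi]; exact Finset.prod_eq_one fun i _ => hp1 i
  have point : ∀ ω : (∀ i, Ω i), ∏ i, p i (ω i) ≤ (if G ω then ∏ i, p i (ω i) else 0)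
      + ∑ t, ((if η * (S t).card ≤ ∑ i ∈ S t, (Z i (ω i) - m i) then ∏ i, p i (ω i) else 0)
        + if η * (S t).card ≤ ∑ i ∈ S t, (m i - Z i (ω i)) then ∏ i, p i (ω i) else 0) := by
    intro ω
    have hpos : 0 ≤ ∏ i, p i (ω i) := Finset.prod_nonneg fun i _ => hp i _
    have hterm : ∀ t, 0 ≤
        ((if η * (S t).card ≤ ∑ i ∈ S t, (Z i (ω i) - m i) then ∏ i, p i (ω i) else 0)
        + if η * (S t).card ≤ ∑ i ∈ S t, (m i - Z i (ω i)) then ∏ i, p i (ω i) else 0) :=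
      fun t => by split_ifs <;> positivity
    by_cases hg : G ω
    · rw [if_pos hg]
      exact le_add_of_nonneg_right (Finset.sum_nonneg fun t _ => hterm t)
    · rw [if_neg hg, zero_add]
      obtain ⟨t, ht⟩ := not_forall.1 fun h => hg (hG ω h)
      refine le_trans ?_ (Finset.single_le_sum (fun t _ => hterm t) (Finset.mem_univ t))
      have hms : ∑ i ∈ S t, m i = N * μ t := by
        rw [Finset.sum_congr rfl fun i hi => hmean t i hi, Finset.sum_const, hS, nsmul_eq_mul]
      have e : (∑ i ∈ S t, Z i (ω i)) / N - μ t
          = (∑ i ∈ S t, Z i (ω i) - N * μ t) / N := by field_simp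
      rw [not_le, e, lt_abs, ← neg_div, lt_div_iff₀ hN', lt_div_iff₀ hN'] at ht
      simp only [Finset.sum_sub_distrib, hms, hS]
      rcases ht with ht | ht
      · rw [if_pos ht.le]
        exact le_add_of_nonneg_right (by split_ifs <;> positivity)
      · have ht' : η * (N : ℝ) ≤ N * μ t - ∑ i ∈ S t, Z i (ω i) := by linarith
        rw [if_pos ht']
        exact le_add_of_nonneg_left (by split_ifs <;> positivity)
  have := Finset.sum_le_sum fun ω (_ : ω ∈ Finset.univ) => point ω
  rw [total, Finset.sum_add_distrib, Finset.sum_comm, ← Finset.sum_filter] at this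
  have hb : ∑ t, ∑ ω : (∀ i, Ω i),
      ((if η * (S t).card ≤ ∑ i ∈ S t, (Z i (ω i) - m i) then ∏ i, p i (ω i) else 0)
        + if η * (S t).card ≤ ∑ i ∈ S t, (m i - Z i (ω i)) then ∏ i, p i (ω i) else 0)
      ≤ Fintype.card T * (2 * Real.exp (-(N * η ^ 2 / 16))) := by
    refine (Finset.sum_le_card_nsmul _ _ (2 * Real.exp (-(N * η ^ 2 / 16))) fun t _ => ?_).trans_eq
      (by rw [nsmul_eq_mul]; rfl)
    rw [Finset.sum_add_distrib]
    have h1 := up t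
    have h2 := lo t
    rw [hS] at h1 h2 ⊢
    linarith
  linarith

end Concentration

/-! ### Tensor products, Hadamard conjugations and permutation operators. -/

section Tensor

variable {a s d : ℕ}

/-- The tensor product of operators on the qubits and an operator on the registers. -/
noncomputable def tensorOp (M : Fin a → Matrix Bool Bool ℂ)
    (A : Matrix (Fin s → Fin d) (Fin s → Fin d) ℂ) : Operator a s d :=
  Matrix.of fun x y => (∏ q, M q (x.1 q) (y.1 q)) * A x.2 y.2

/-- The tensor power of an operator. -/
noncomputable def tensorPower (s : ℕ) (ρ : Matrix (Fin d) (Fin d) ℂ) :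
    Matrix (Fin s → Fin d) (Fin s → Fin d) ℂ :=
  Matrix.of fun x y => ∏ i, ρ (x i) (y i)

lemma tensorOp_mul (M N : Fin a → Matrix Bool Bool ℂ)
    (A B : Matrix (Fin s → Fin d) (Fin s → Fin d) ℂ) :
    tensorOp M A * tensorOp N B = tensorOp (fun q => M q * N q) (A * B) := by
  ext x y
  simp only [tensorOp, Matrix.mul_apply, Matrix.of_apply, Fintype.sum_prod_type]
  rw [Finset.prod_univ_sum, Fintype.piFinset_univ, Finset.sum_mul_sum]
  refine Finset.sum_congr rfl fun b _ => Finset.sum_congr rfl fun z _ => ?_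
  rw [Finset.prod_mul_distrib]
  ring

lemma tensorOp_conjTranspose (M : Fin a → Matrix Bool Bool ℂ)
    (A : Matrix (Fin s → Fin d) (Fin s → Fin d) ℂ) :
    (tensorOp M A)ᴴ = tensorOp (fun q => (M q)ᴴ) Aᴴ := by
  ext x y
  simp [tensorOp, Matrix.conjTranspose_apply]

lemma tensorOp_one : tensorOp (fun _ => 1) 1 = (1 : Operator a s d) := by
  ext x y
  simp only [tensorOp, Matrix.of_apply, Matrix.one_apply]
  rw [Finset.prod_ite_zero]
  have e : (∀ i ∈ Finset.univ, x.1 i = y.1 i) ↔ x.1 = y.1 := by simp [funext_iff]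
  simp only [e, Prod.ext_iff]
  by_cases h1 : x.1 = y.1 <;> by_cases h2 : x.2 = y.2 <;> simp [h1, h2]

lemma trace_tensorOp (M : Fin a → Matrix Bool Bool ℂ)
    (A : Matrix (Fin s → Fin d) (Fin s → Fin d) ℂ) :
    (tensorOp M A).trace = (∏ q, (M q).trace) * A.trace := by
  simp only [tensorOp, Matrix.trace, Matrix.diag_apply, Matrix.of_apply, Fintype.sum_prod_type]
  rw [Finset.prod_univ_sum, Fintype.piFinset_univ, Finset.sum_mul_sum]

lemma tensorPower_mul (ρ σ : Matrix (Fin d) (Fin d) ℂ) :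
    tensorPower s (ρ * σ) = tensorPower s ρ * tensorPower s σ := by
  ext x y
  simp only [tensorPower, Matrix.mul_apply, Matrix.of_apply]
  rw [Finset.prod_univ_sum, Fintype.piFinset_univ]
  exact Finset.sum_congr rfl fun z _ => Finset.prod_mul_distrib

lemma tensorPower_conjTranspose (ρ : Matrix (Fin d) (Fin d) ℂ) :
    (tensorPower s ρ)ᴴ = tensorPower s ρᴴ := by
  ext x y
  simp [tensorPower, Matrix.conjTranspose_apply]

lemma trace_tensorPower (ρ : Matrix (Fin d) (Fin d) ℂ) :
    (tensorPower s ρ).trace = ρ.trace ^ s := by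
  simp only [tensorPower, Matrix.trace, Matrix.diag_apply, Matrix.of_apply]
  rw [Fintype.sum_pow]

/-- The projector onto `|0⟩`. -/
noncomputable def ketZeroProj : Matrix Bool Bool ℂ := Matrix.of fun p q => if p = false ∧ q = false then 1 else 0

/-- The Hadamard matrix. -/
noncomputable def hadamardMatrix : Matrix Bool Bool ℂ :=
  Matrix.of fun p q => (if p = true ∧ q = true then -1 else 1) / (Real.sqrt 2 : ℂ)

/-- The Pauli matrix `Z`. -/
noncomputable def pauliZ : Matrix Bool Bool ℂ := Matrix.diagonal fun p => if p = true then -1 else 1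

lemma sqrt_two_mul_self : (Real.sqrt 2 : ℂ) * (Real.sqrt 2 : ℂ) = 2 := by
  rw [← Complex.ofReal_mul, Real.mul_self_sqrt (by norm_num)]; norm_num

lemma hadamardMatrix_mul_self : hadamardMatrix * hadamardMatrix = 1 := by
  ext p q
  have h := sqrt_two_mul_self
  have h' : (Real.sqrt 2 : ℂ)⁻¹ * (Real.sqrt 2 : ℂ)⁻¹ = 2⁻¹ := by rw [← mul_inv, h]
  cases p <;> cases q <;>
    simp [hadamardMatrix, Matrix.mul_apply, div_eq_mul_inv, h']
  norm_num

lemma hadamardMatrix_conjTranspose : hadamardMatrixᴴ = hadamardMatrix := by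
  ext p q
  cases p <;> cases q <;> simp [hadamardMatrix, Matrix.conjTranspose_apply]

lemma hadamard_ketZeroProj_hadamard :
    hadamardMatrix * ketZeroProj * hadamardMatrix = Matrix.of fun _ _ => 1 / 2 := by
  ext p q
  have h := sqrt_two_mul_self
  have h' : (Real.sqrt 2 : ℂ)⁻¹ * (Real.sqrt 2 : ℂ)⁻¹ = 2⁻¹ := by rw [← mul_inv, h]
  cases p <;> cases q <;>
    simp [hadamardMatrix, ketZeroProj, Matrix.mul_apply, div_eq_mul_inv, h']

lemma hadamard_pauliZ_hadamard :
    hadamardMatrix * pauliZ * hadamardMatrix = Matrix.of fun p q => if p = !q then 1 else 0 := by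
  ext p q
  have h := sqrt_two_mul_self
  have h' : (Real.sqrt 2 : ℂ)⁻¹ * (Real.sqrt 2 : ℂ)⁻¹ = 2⁻¹ := by rw [← mul_inv, h]
  cases p <;> cases q <;>
    simp [hadamardMatrix, pauliZ, Matrix.mul_apply, Matrix.diagonal_apply, div_eq_mul_inv, h'] <;>
    norm_num

lemma basisMap_mul (f g : BasisLabel a s d → BasisLabel a s d) :
    basisMap f * basisMap g = basisMap (f ∘ g) := by
  ext x y
  simp [basisMap, Matrix.mul_apply]

lemma basisMap_id : basisMap id = (1 : Operator a s d) := by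
  ext x y
  simp [basisMap, Matrix.one_apply]

lemma basisMap_conjTranspose {f : BasisLabel a s d → BasisLabel a s d}
    (hf : Function.Involutive f) : (basisMap f)ᴴ = basisMap f := by
  ext x y
  simp only [basisMap, Matrix.conjTranspose_apply, Matrix.of_apply]
  have : y = f x ↔ x = f y := ⟨fun h => by rw [h, hf], fun h => by rw [h, hf]⟩
  simp [this]

lemma basisMap_mul_self {f : BasisLabel a s d → BasisLabel a s d}
    (hf : Function.Involutive f) : basisMap f * basisMap f = 1 := by
  rw [basisMap_mul, hf.comp_self, basisMap_id]

lemma trace_basisMap_mul (f : BasisLabel a s d → BasisLabel a s d) (A : Operator a s d) :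
    (basisMap f * A).trace = ∑ y, A y (f y) := by
  simp only [Matrix.trace, Matrix.diag_apply, Matrix.mul_apply, basisMap, Matrix.of_apply]
  rw [Finset.sum_comm]
  simp

lemma toOperator_hadamard (q : Fin a) :
    Gate.toOperator d (Gate.hadamard q : Gate a s)
      = tensorOp (fun p => if p = q then hadamardMatrix else 1) 1 := by
  ext x y
  simp only [Gate.toOperator, tensorOp, Matrix.of_apply, Matrix.one_apply]
  rw [← Finset.mul_prod_erase _ _ (Finset.mem_univ q)]
  have h : ∏ p ∈ Finset.univ.erase q, (if p = q then hadamardMatrix else 1) (x.1 p) (y.1 p)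
      = if ∀ p, p ≠ q → x.1 p = y.1 p then (1 : ℂ) else 0 := by
    rw [Finset.prod_congr rfl (g := fun p => if x.1 p = y.1 p then (1 : ℂ) else 0)]
    · rw [Finset.prod_ite_zero]
      simp
    · intro p hp
      rw [if_neg (Finset.ne_of_mem_erase hp), Matrix.one_apply]
  rw [h, if_pos rfl]
  by_cases h1 : x.2 = y.2 <;> by_cases h2 : ∀ p, p ≠ q → x.1 p = y.1 p <;>
    simp [h1, h2, hadamardMatrix]

lemma hadamard_list_prod (l : List (Fin a)) (hl : l.Nodup) :
    ((l.map fun q => (Gate.hadamard q : Gate a s)).map (Gate.toOperator d)).prod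
      = tensorOp (fun p => if p ∈ l then hadamardMatrix else 1) 1 := by
  induction l with
  | nil => simp [tensorOp_one]
  | cons q l ih =>
    rw [List.nodup_cons] at hl
    rw [List.map_cons, List.map_cons, List.prod_cons, ih hl.2, toOperator_hadamard, tensorOp_mul,
      mul_one]
    congr 1
    ext1 p
    by_cases h : p = q
    · subst h; simp [hl.1]
    · simp [h]

end Tensor

/-! ### Layers of controlled swaps along an involution. -/

section Reflection

variable {a s d : ℕ}

/-- The controlled swaps along the two-cycles of `τ`, with control `e i` for the cycle whose
smaller element is `i`. -/
def swapGates (e : Fin s → Fin a) (τ : Fin s → Fin s) (l : List (Fin s)) : List (Gate a s) :=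
  l.filterMap fun i => if h : i < τ i then some (Gate.cswap (e i) i (τ i) h.ne) else none

lemma swapGates_pairwise {e : Fin s → Fin a} (he : Function.Injective e) {τ : Fin s → Fin s}
    (hτ : Function.Involutive τ) {l : List (Fin s)} (hl : l.Nodup) :
    (swapGates e τ l).Pairwise fun u v => Disjoint u.wires v.wires := by
  rw [swapGates, List.pairwise_filterMap]
  refine hl.imp ?_
  intro i j hij u hu v hv
  split_ifs at hu hv with h1 h2
  all_goals simp only [Option.some.injEq] at hu hv
  subst hu hv
  have n1 : e i ≠ e j := fun h => hij (he h)
  have n2 : τ i ≠ τ j := fun h => hij (hτ.injective h)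
  have n3 : i ≠ τ j := by
    intro h
    have : τ i = j := by rw [h, hτ]
    rw [this, h] at h1
    exact absurd h1 h2.asymm
  have n4 : τ i ≠ j := fun h => n3 (by rw [← h, hτ])
  simp [Gate.wires, n1.symm, n2.symm, n3.symm, n4.symm, hij.symm]

/-- The involution that acts as `τ` on the two-cycles selected by `b`. -/
def maskedPerm (e : Fin s → Fin a) (τ : Fin s → Fin s) (b : Fin a → Bool) (k : Fin s) : Fin s :=
  if b (e (min k (τ k))) = true then τ k else k

lemma maskedPerm_involutive (e : Fin s → Fin a) {τ : Fin s → Fin s}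
    (hτ : Function.Involutive τ) (b : Fin a → Bool) :
    Function.Involutive (maskedPerm e τ b) := by
  intro k
  unfold maskedPerm
  by_cases h : b (e (min k (τ k))) = true
  · simp [h, hτ k, min_comm (τ k) k]
  · simp [h]

/-- Each two-cycle is selected by exactly one of a mask and its complement, so composing the two
partial reflections gives all of `τ`. -/
lemma maskedPerm_not (e : Fin s → Fin a) {τ : Fin s → Fin s}
    (hτ : Function.Involutive τ) (b : Fin a → Bool) (k : Fin s) :
    maskedPerm e τ b (maskedPerm e τ (fun q => !b q) k) = τ k := by
  unfold maskedPerm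
  by_cases h : b (e (min k (τ k))) = true
  · simp [h]
  · simp [h, hτ k, min_comm (τ k) k]

/-- The action of the controlled swaps on the basis labels. -/
def maskedMap (d : ℕ) (e : Fin s → Fin a) (τ : Fin s → Fin s) (y : BasisLabel a s d) :
    BasisLabel a s d :=
  (y.1, y.2 ∘ maskedPerm e τ y.1)

lemma maskedMap_involutive (e : Fin s → Fin a) {τ : Fin s → Fin s}
    (hτ : Function.Involutive τ) : Function.Involutive (maskedMap d e τ) := by
  intro y
  refine Prod.ext rfl ?_
  ext1 k
  simp only [maskedMap, Function.comp_apply]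
  rw [maskedPerm_involutive e hτ]

/-- The form needed for induction on the list: a two-cycle is active once its smaller element lies
in `l` and its control is set. -/
lemma swapGates_prod_of_nodup (e : Fin s → Fin a) {τ : Fin s → Fin s}
    (hτ : Function.Involutive τ) (l : List (Fin s)) (hl : l.Nodup) :
    ((swapGates e τ l).map (Gate.toOperator d)).prod
      = basisMap fun y : BasisLabel a s d => (y.1, fun k => y.2
        (if (k ∈ l ∧ k < τ k ∧ y.1 (e k) = true) ∨ (τ k ∈ l ∧ τ k < k ∧ y.1 (e (τ k)) = true)
          then τ k else k)) := by
  induction l with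
  | nil =>
    simp only [swapGates, List.filterMap_nil, List.map_nil, List.prod_nil]
    rw [← basisMap_id]
    congr 1
  | cons i l ih =>
    rw [List.nodup_cons] at hl
    have ih := ih hl.2
    by_cases h : i < τ i
    · have e1 : swapGates e τ (i :: l) = Gate.cswap (e i) i (τ i) h.ne :: swapGates e τ l := by
        simp [swapGates, h]
      rw [e1, List.map_cons, List.prod_cons, ih, Gate.toOperator, basisMap_mul]
      congr 1
      ext1 y
      refine Prod.ext rfl ?_
      ext1 k
      by_cases hb : y.1 (e i) = true
      · simp only [Function.comp_apply, hb, if_true, Equiv.swap_apply_def]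
        by_cases k1 : k = i
        · subst k1
          have : ¬ τ k < k := h.asymm
          simp [hτ k, h, hb, hl.1, this]
        · by_cases k2 : k = τ i
          · subst k2
            have : ¬ τ i < i := h.asymm
            simp [hτ i, h, hb, hl.1, this, h.ne']
          · have k3 : τ k ≠ i := fun h => k2 (by rw [← h, hτ])
            simp [k1, k2, k3]
      · simp only [Function.comp_apply, hb]
        by_cases k1 : k = i
        · subst k1
          have : ¬ τ k < k := h.asymm
          simp [hb, hl.1, this]
        · by_cases k2 : k = τ i
          · subst k2
            have : ¬ τ i < i := h.asymm
            simp [hτ i, hb, hl.1, this, h.ne']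
          · have k3 : τ k ≠ i := fun h => k2 (by rw [← h, hτ])
            simp [k1, k3]
    · have e1 : swapGates e τ (i :: l) = swapGates e τ l := by
        simp [swapGates, h]
      rw [e1, ih]
      congr 1
      ext1 y
      refine Prod.ext rfl ?_
      ext1 k
      by_cases k1 : k = i
      · subst k1
        by_cases k2 : τ k = k
        · simp [k2]
        · simp [h, k2]
      · by_cases k2 : k = τ i
        · subst k2
          simp [hτ i, h, k1]
        · have k3 : τ k ≠ i := fun h => k2 (by rw [← h, hτ])
          simp [k1, k3]

lemma swapGates_prod (e : Fin s → Fin a) {τ : Fin s → Fin s} (hτ : Function.Involutive τ) :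
    ((swapGates e τ (List.finRange s)).map (Gate.toOperator d)).prod
      = basisMap (maskedMap d e τ) := by
  rw [swapGates_prod_of_nodup e hτ _ (List.nodup_finRange s)]
  congr 1
  ext1 y
  refine Prod.ext rfl ?_
  ext1 k
  simp only [maskedMap, maskedPerm, Function.comp_apply, List.mem_finRange, true_and]
  rcases lt_trichotomy k (τ k) with h | h | h
  · simp [h, h.asymm, min_eq_left h.le]
  · simp [← h]
  · simp [h, h.asymm, min_eq_right h.le]

end Reflection

/-! ### Traces of powers as sums over closed paths. -/

section TracePower

variable {ι : Type*} [Fintype ι] [DecidableEq ι]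

/-- The tuple `x` lists the interior vertices of a path of `n + 1` edges; prepending `u` lists the
sources of the edges, appending `v` their targets. -/
lemma pow_succ_apply_eq_sum_paths (M : Matrix ι ι ℂ) (n : ℕ) (u v : ι) :
    (M ^ (n + 1)) u v = ∑ x : Fin n → ι, ∏ i : Fin (n + 1),
      M (Fin.cons (α := fun _ => ι) u x i) (Fin.snoc (α := fun _ => ι) x v i) := by
  induction n generalizing u with
  | zero =>
    simp [Fin.snoc]
  | succ n ih =>
    rw [pow_succ', Matrix.mul_apply, ← (Fin.consEquiv fun _ => ι).sum_comp,
      Fintype.sum_prod_type]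
    refine Finset.sum_congr rfl fun w _ => ?_
    rw [ih, Finset.mul_sum]
    refine Finset.sum_congr rfl fun x _ => ?_
    have e : (Fin.consEquiv fun _ : Fin (n + 1) => ι) (w, x) = Fin.cons w x := rfl
    rw [e, ← Fin.cons_snoc_eq_snoc_cons]
    conv_rhs => rw [Fin.prod_univ_succ]
    simp only [Fin.cons_zero, Fin.cons_succ]

lemma trace_pow_succ_eq_sum_cycles (M : Matrix ι ι ℂ) (n : ℕ) :
    (M ^ (n + 1)).trace = ∑ x : Fin (n + 1) → ι, ∏ i, M (x i) (x (i + 1)) := by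
  rw [Matrix.trace, ← (Fin.consEquiv fun _ => ι).sum_comp, Fintype.sum_prod_type]
  refine Finset.sum_congr rfl fun u _ => ?_
  rw [Matrix.diag_apply, pow_succ_apply_eq_sum_paths]
  refine Finset.sum_congr rfl fun x _ => Finset.prod_congr rfl fun i _ => ?_
  congr 1
  refine Fin.lastCases ?_ (fun i => ?_) i
  · simp [Fin.consEquiv]
  · simp [Fin.consEquiv, Fin.coeSucc_eq_succ]

end TracePower

/-! ### The constant-depth test for the trace of a power. -/

section CycleTest

/-- The controls of the first layer of swaps. -/
abbrev leftWire (n : ℕ) : Fin (n + 1) → Fin ((n + 1) + (n + 1)) := Fin.castAdd (n + 1)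

/-- The controls of the second layer of swaps. -/
abbrev rightWire (n : ℕ) : Fin (n + 1) → Fin ((n + 1) + (n + 1)) := Fin.natAdd (n + 1)

lemma leftWire_injective (n : ℕ) : Function.Injective (leftWire n) :=
  Fin.castAdd_injective _ _

lemma rightWire_injective (n : ℕ) : Function.Injective (rightWire n) :=
  Fin.natAdd_injective _ _

lemma fin_neg_involutive (n : ℕ) : Function.Involutive fun i : Fin (n + 1) => -i := neg_neg

/-- The factorisation of the cyclic shift into two reflections: `Fin.rev` is `i ↦ -1 - i` modulo `n
+ 1`. -/
lemma neg_rev (n : ℕ) (i : Fin (n + 1)) : -Fin.rev i = i + 1 := by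
  rw [neg_eq_iff_add_eq_zero]
  ext
  simp only [Fin.val_add, Fin.val_rev, Fin.val_zero, Fin.val_one', Nat.add_mod_mod]
  have : n + 1 - (i.val + 1) + (i.val + 1) = n + 1 := by omega
  rw [this, Nat.mod_self]

lemma hadamardGates_pairwise (a s : ℕ) :
    ((List.finRange a).map fun q => (Gate.hadamard q : Gate a s)).Pairwise
      fun u v => Disjoint u.wires v.wires := by
  rw [List.pairwise_map]
  refine (List.nodup_finRange a).imp fun {i j} h => ?_
  simp [Gate.wires, h]

/-- The circuit for the trace of the power `n + 1`: a cyclic shift of `n + 1` registers, written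
as a product of two reflections, is applied by two layers of controlled swaps with independent
controls. -/
def cycleTest (n : ℕ) : Circuit where
  ancillas := (n + 1) + (n + 1)
  registers := n + 1
  layers :=
    [Layer.gates _ (hadamardGates_pairwise _ _),
      Layer.gates _ (swapGates_pairwise (leftWire_injective n) Fin.rev_involutive
        (List.nodup_finRange _)),
      Layer.gates _ (swapGates_pairwise (rightWire_injective n) (fin_neg_involutive n)
        (List.nodup_finRange _)),
      Layer.gates _ (hadamardGates_pairwise _ _),
      Layer.measure Finset.univ]

/-- A crude count, in which even the Hadamard gates are included: only linearity in `n + 1` matters.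
-/
lemma cycleTest_numCSwap_le (n : ℕ) : (cycleTest n).numCSwap ≤ 6 * (n + 1) := by
  have h1 := List.countP_le_length (p := Gate.isCSwap)
    (l := (List.finRange ((n + 1) + (n + 1))).map
      fun q => (Gate.hadamard q : Gate ((n + 1) + (n + 1)) (n + 1)))
  have h2 : ∀ (e : Fin (n + 1) → Fin ((n + 1) + (n + 1))) (τ : Fin (n + 1) → Fin (n + 1)),
      (swapGates e τ (List.finRange (n + 1))).countP Gate.isCSwap ≤ n + 1 := fun e τ =>
    (List.countP_le_length).trans ((List.length_filterMap_le _ _).trans (by simp))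
  have h3 := h2 (leftWire n) Fin.rev
  have h4 := h2 (rightWire n) fun i => -i
  simp only [List.length_map, List.length_finRange] at h1
  simp only [cycleTest, Circuit.numCSwap, List.map_cons, List.map_nil, List.sum_cons,
    List.sum_nil, Layer.numCSwap]
  omega

variable {d : ℕ}

/-- The state before the first layer. -/
noncomputable def inputState (a s : ℕ) (ρ : Matrix (Fin d) (Fin d) ℂ) : Operator a s d :=
  tensorOp (fun _ => ketZeroProj) (tensorPower s ρ)

/-- The Hadamard gate on every ancilla. -/
noncomputable def hadamardAll (a s d : ℕ) : Operator a s d := tensorOp (fun _ => hadamardMatrix) 1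

/-- The unitary of the gates of `cycleTest`. -/
noncomputable def cycleUnitary (n d : ℕ) : Operator ((n + 1) + (n + 1)) (n + 1) d :=
  hadamardAll _ _ d * (basisMap (maskedMap d (rightWire n) fun i => -i) *
    (basisMap (maskedMap d (leftWire n) Fin.rev) * hadamardAll _ _ d))

lemma hadamardAll_mul_self (a s : ℕ) : hadamardAll a s d * hadamardAll a s d = 1 := by
  rw [hadamardAll, tensorOp_mul, mul_one]
  simp only [hadamardMatrix_mul_self]
  exact tensorOp_one

lemma hadamardAll_conjTranspose (a s : ℕ) : (hadamardAll a s d)ᴴ = hadamardAll a s d := by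
  rw [hadamardAll, tensorOp_conjTranspose, Matrix.conjTranspose_one]
  simp only [hadamardMatrix_conjTranspose]

lemma hadamardGates_prod (a s : ℕ) :
    (((List.finRange a).map fun q => (Gate.hadamard q : Gate a s)).map (Gate.toOperator d)).prod
      = hadamardAll a s d := by
  rw [hadamard_list_prod _ (List.nodup_finRange a), hadamardAll]
  simp

lemma cycleUnitary_conjTranspose (n : ℕ) : (cycleUnitary n d)ᴴ
    = hadamardAll _ _ d * (basisMap (maskedMap d (leftWire n) Fin.rev) *
      (basisMap (maskedMap d (rightWire n) fun i => -i) * hadamardAll _ _ d)) := by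
  rw [cycleUnitary]
  simp only [Matrix.conjTranspose_mul, hadamardAll_conjTranspose,
    basisMap_conjTranspose (maskedMap_involutive (leftWire n) Fin.rev_involutive),
    basisMap_conjTranspose (maskedMap_involutive (rightWire n) (fin_neg_involutive n)),
    Matrix.mul_assoc]

lemma cycleUnitary_isometry (n : ℕ) : (cycleUnitary n d)ᴴ * cycleUnitary n d = 1 := by
  rw [cycleUnitary_conjTranspose, cycleUnitary]
  have h1 := hadamardAll_mul_self (d := d) ((n + 1) + (n + 1)) (n + 1)
  have h2 := basisMap_mul_self
    (maskedMap_involutive (d := d) (rightWire n) (fin_neg_involutive n))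
  have h3 := basisMap_mul_self
    (maskedMap_involutive (d := d) (leftWire n) Fin.rev_involutive)
  set A := hadamardAll ((n + 1) + (n + 1)) (n + 1) d
  set B := basisMap (maskedMap d (rightWire n) fun i => -i)
  set D := basisMap (maskedMap d (leftWire n) Fin.rev)
  calc A * (D * (B * A)) * (A * (B * (D * A))) = A * D * B * (A * A) * B * D * A := by
        simp only [Matrix.mul_assoc]
    _ = A * D * (B * B) * D * A := by rw [h1, mul_one]; simp only [Matrix.mul_assoc]
    _ = A * (D * D) * A := by rw [h2, mul_one]; simp only [Matrix.mul_assoc]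
    _ = 1 := by rw [h3, mul_one, h1]

/-- All classical bits are zero, and the quantum wires are in the state `A`. -/
noncomputable def zeroSupported {a s : ℕ} (A : Operator a s d) : CQState a s d := fun c =>
  if c = fun _ => false then A else 0

lemma act_gates_zeroSupported {a s : ℕ} (l : List (Gate a s))
    (h : l.Pairwise fun u v => Disjoint u.wires v.wires) (A : Operator a s d) :
    (Layer.gates l h).act (zeroSupported A)
      = zeroSupported ((l.map (Gate.toOperator d)).prod * A *
          ((l.map (Gate.toOperator d)).prod)ᴴ) := by
  ext1 c
  simp only [Layer.act, zeroSupported]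
  split_ifs <;> simp

lemma act_measure_univ_zeroSupported {a s : ℕ} (A : Operator a s d) (c : Fin a → Bool) :
    (Layer.measure Finset.univ).act (zeroSupported A) c
      = projector Finset.univ c * A * projector Finset.univ c := by
  simp [Layer.act, zeroSupported]

lemma initial_eq (Q : Circuit) (ρ : Matrix (Fin d) (Fin d) ℂ) :
    Q.initial ρ = zeroSupported (inputState Q.ancillas Q.registers ρ) := by
  ext1 c
  simp only [Circuit.initial, zeroSupported]
  congr 1
  ext x y
  simp only [inputState, tensorOp, tensorPower, ketZeroProj, Matrix.of_apply]
  rw [Finset.prod_ite_zero]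
  have e : (∀ i ∈ Finset.univ, x.1 i = false ∧ y.1 i = false)
      ↔ x.1 = (fun _ => false) ∧ y.1 = fun _ => false := by
    simp [funext_iff, forall_and]
  simp only [e]
  split_ifs <;> simp

lemma cycleTest_prob (n : ℕ) (ρ : Matrix (Fin d) (Fin d) ℂ)
    (c : Fin ((n + 1) + (n + 1)) → Bool) :
    (cycleTest n).prob ρ c = (projector Finset.univ c *
      (cycleUnitary n d * inputState _ _ ρ * (cycleUnitary n d)ᴴ) *
        projector Finset.univ c).trace.re := by
  rw [← act_measure_univ_zeroSupported]
  have h : zeroSupported (cycleUnitary n d * inputState _ _ ρ * (cycleUnitary n d)ᴴ)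
      = (Layer.gates _ (hadamardGates_pairwise _ _)).act
        ((Layer.gates _ (swapGates_pairwise (rightWire_injective n) (fin_neg_involutive n)
          (List.nodup_finRange _))).act
        ((Layer.gates _ (swapGates_pairwise (leftWire_injective n) Fin.rev_involutive
          (List.nodup_finRange _))).act
        ((Layer.gates _ (hadamardGates_pairwise _ _)).act
          (zeroSupported (inputState ((n + 1) + (n + 1)) (n + 1) ρ))))) := by
    simp only [act_gates_zeroSupported]
    rw [hadamardGates_prod, swapGates_prod _ Fin.rev_involutive,
      swapGates_prod _ (fin_neg_involutive n)]
    simp only [cycleUnitary, Matrix.conjTranspose_mul, Matrix.mul_assoc]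
  rw [h]
  simp only [Circuit.prob, Circuit.final, initial_eq]
  rfl

/-- Writing `ρ = Bᴴ B` turns the input state into `Tᴴ T`, where `T` is the tensor product of the
projectors with the tensor power of `B`. -/
lemma inputState_posSemidef (a s : ℕ) {ρ : Matrix (Fin d) (Fin d) ℂ} (hρ : ρ.PosSemidef) :
    (inputState a s ρ).PosSemidef := by
  obtain ⟨B, rfl⟩ : ∃ B : Matrix (Fin d) (Fin d) ℂ, ρ = Bᴴ * B := by
    open scoped MatrixOrder Matrix.Norms.L2Operator in
    exact CStarAlgebra.nonneg_iff_eq_star_mul_self.1 hρ.nonneg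
  have h0 : ketZeroProjᴴ * ketZeroProj = ketZeroProj := by
    ext p q
    cases p <;> cases q <;>
      simp [ketZeroProj, Matrix.mul_apply, Matrix.conjTranspose_apply]
  have h : inputState a s (Bᴴ * B)
      = (tensorOp (fun _ => ketZeroProj) (tensorPower s B) : Operator a s d)ᴴ
        * tensorOp (fun _ => ketZeroProj) (tensorPower s B) := by
    rw [tensorOp_conjTranspose, tensorOp_mul, tensorPower_conjTranspose, ← tensorPower_mul]
    simp only [h0]
    rfl
  rw [h]
  exact Matrix.posSemidef_conjTranspose_mul_self _

lemma projector_conjTranspose {a s : ℕ} (M : Finset (Fin a)) (c : Fin a → Bool) :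
    (projector M c : Operator a s d)ᴴ = projector M c := by
  rw [projector, Matrix.diagonal_conjTranspose]
  congr 1
  ext1 y
  simp only [Pi.star_apply]
  split_ifs <;> simp

theorem cycleTest_prob_nonneg (n : ℕ) {ρ : Matrix (Fin d) (Fin d) ℂ} (hρ : IsDensity ρ)
    (c : Fin ((n + 1) + (n + 1)) → Bool) : 0 ≤ (cycleTest n).prob ρ c := by
  have h := ((inputState_posSemidef ((n + 1) + (n + 1)) (n + 1)
    hρ.posSemidef).mul_mul_conjTranspose_same (cycleUnitary n d)).mul_mul_conjTranspose_same
    (projector Finset.univ c)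
  rw [projector_conjTranspose] at h
  rw [cycleTest_prob]
  exact (Complex.le_def.1 h.trace_nonneg).1

lemma trace_projector_mul {a s : ℕ} (c : Fin a → Bool) (A : Operator a s d) :
    (projector Finset.univ c * A * projector Finset.univ c).trace
      = ∑ x, A (c, x) (c, x) := by
  simp only [Matrix.trace, Matrix.diag_apply, projector, Matrix.mul_diagonal,
    Matrix.diagonal_mul, Fintype.sum_prod_type]
  rw [Finset.sum_eq_single c]
  · simp
  · intro b _ hb
    have : ¬ ∀ q, b q = c q := fun h => hb (funext h)
    simp [this]
  · simp

/-- Classical averages become expectations of a diagonal observable. The choices `w = 1` and `w =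
paritySign` give normalisation and mean. -/
lemma sum_mul_prob (n : ℕ) (ρ : Matrix (Fin d) (Fin d) ℂ)
    (w : (Fin ((n + 1) + (n + 1)) → Bool) → ℝ) :
    ∑ c : Fin ((n + 1) + (n + 1)) → Bool, (cycleTest n).prob ρ c * w c
      = ((Matrix.diagonal (fun y => ((w y.1 : ℝ) : ℂ)) : Operator _ _ d) *
          (cycleUnitary n d * inputState _ _ ρ * (cycleUnitary n d)ᴴ)).trace.re := by
  simp only [Matrix.trace, Matrix.diag_apply, Matrix.diagonal_mul]
  rw [Fintype.sum_prod_type, Complex.re_sum]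
  refine Finset.sum_congr rfl fun c _ => ?_
  rw [cycleTest_prob, trace_projector_mul]
  dsimp only
  rw [← Finset.mul_sum, Complex.re_ofReal_mul, mul_comm]

theorem cycleTest_sum_prob (n : ℕ) {ρ : Matrix (Fin d) (Fin d) ℂ} (hρ : IsDensity ρ) :
    ∑ c : Fin ((n + 1) + (n + 1)) → Bool, (cycleTest n).prob ρ c = 1 := by
  have h := sum_mul_prob n ρ fun _ => 1
  simp only [mul_one, Complex.ofReal_one, Matrix.diagonal_one, one_mul] at h
  rw [h, Matrix.trace_mul_comm, ← Matrix.mul_assoc, cycleUnitary_isometry, one_mul, inputState,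
    trace_tensorOp, trace_tensorPower, hρ.trace_one]
  have : ketZeroProj.trace = 1 := by simp [Matrix.trace, ketZeroProj]
  simp [this]

/-- The parity sign of an outcome. -/
def paritySign {a : ℕ} (c : Fin a → Bool) : ℝ := ∏ q, if c q = true then -1 else 1

lemma abs_paritySign {a : ℕ} (c : Fin a → Bool) : |paritySign c| = 1 := by
  rw [paritySign, Finset.abs_prod]
  exact Finset.prod_eq_one fun q _ => by split_ifs <;> simp

lemma diagonal_paritySign (a s : ℕ) :
    (Matrix.diagonal (fun y => ((paritySign y.1 : ℝ) : ℂ)) : Operator a s d)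
      = tensorOp (fun _ => pauliZ) 1 := by
  ext x y
  simp only [tensorOp, Matrix.diagonal_apply, Matrix.of_apply, pauliZ, Matrix.one_apply,
    paritySign]
  rw [Finset.prod_ite_zero]
  have e : (∀ i ∈ Finset.univ, x.1 i = y.1 i) ↔ x.1 = y.1 := by simp [funext_iff]
  simp only [e, Prod.ext_iff]
  by_cases h1 : x.1 = y.1 <;> by_cases h2 : x.2 = y.2 <;> simp [h1, h2]
  exact Finset.prod_congr rfl fun q _ => by split_ifs <;> simp

/-- Conjugation by Hadamards turns `Z` into `X`; this is how the parity observable comes to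
complement all controls. -/
lemma hadamardAll_mul_pauliZ (a s : ℕ) :
    hadamardAll a s d * tensorOp (fun _ => pauliZ) 1 * hadamardAll a s d
      = basisMap fun y => (fun q => !y.1 q, y.2) := by
  rw [hadamardAll, tensorOp_mul, tensorOp_mul]
  simp only [hadamard_pauliZ_hadamard, mul_one]
  ext x y
  simp only [tensorOp, basisMap, Matrix.of_apply, Matrix.one_apply]
  rw [Finset.prod_ite_zero]
  have e : (∀ i ∈ Finset.univ, x.1 i = !y.1 i) ↔ x.1 = fun q => !y.1 q := by simp [funext_iff]
  simp only [e, Prod.ext_iff]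
  by_cases h1 : x.1 = (fun q => !y.1 q) <;> by_cases h2 : x.2 = y.2 <;> simp [h1, h2]

/-- The expected parity sign of the cycle test is the trace of a power of the state. -/
theorem cycleTest_expectation (n : ℕ) (ρ : Matrix (Fin d) (Fin d) ℂ) :
    ∑ c : Fin ((n + 1) + (n + 1)) → Bool, (cycleTest n).prob ρ c * paritySign c = ((ρ ^ (n + 1)).trace).re := by
  rw [sum_mul_prob]
  congr 1
  have hr : Function.Involutive (Fin.rev : Fin (n + 1) → Fin (n + 1)) := Fin.rev_involutive
  have hn := fin_neg_involutive n
  rw [show (Matrix.diagonal (fun y => ((paritySign y.1 : ℝ) : ℂ)) :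
    Operator ((n + 1) + (n + 1)) (n + 1) d) = tensorOp (fun _ => pauliZ) 1
    from diagonal_paritySign _ _]
  have hX := hadamardAll_mul_pauliZ (d := d) ((n + 1) + (n + 1)) (n + 1)
  rw [cycleUnitary_conjTranspose, cycleUnitary]
  set A := hadamardAll ((n + 1) + (n + 1)) (n + 1) d with hA
  set B := basisMap (maskedMap d (rightWire n) fun i => -i) with hB
  set D := basisMap (maskedMap d (leftWire n) Fin.rev) with hD
  set Z : Operator ((n + 1) + (n + 1)) (n + 1) d := tensorOp (fun _ => pauliZ) 1
  set I := inputState ((n + 1) + (n + 1)) (n + 1) ρ with hI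
  -- Cyclicity moves everything onto the observable: the flip of all ancillas `A Z A`, conjugated by
  -- the swaps, is tested on uniform ancillas and copies of `ρ`.
  have e1 : (Z * (A * (B * (D * A)) * I * (A * (D * (B * A))))).trace
      = ((D * (B * ((A * Z * A) * (B * D)))) * (A * I * A)).trace := by
    calc _ = ((Z * A * B * D * A * I * A) * (D * (B * A))).trace := by
            simp only [Matrix.mul_assoc]
      _ = _ := by
            rw [Matrix.trace_mul_comm]
            simp only [Matrix.mul_assoc]
  have e2 : A * I * A = tensorOp (fun _ => Matrix.of fun _ _ => 1 / 2) (tensorPower (n + 1) ρ) := by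
    rw [hA, hI, hadamardAll, inputState, tensorOp_mul, tensorOp_mul, one_mul, mul_one]
    simp only [hadamard_ketZeroProj_hadamard]
  rw [e1, hX, e2, hB, hD, basisMap_mul, basisMap_mul, basisMap_mul, basisMap_mul,
    trace_basisMap_mul, Fintype.sum_prod_type, trace_pow_succ_eq_sum_cycles]
  -- The permutation that remains is the cyclic shift conjugated by the partial reversal `U`.
  -- Relabelling registers by `U` removes the dependence on `b`.
  have e3 : ∀ b : Fin ((n + 1) + (n + 1)) → Bool,
      ∑ x : Fin (n + 1) → Fin d, ∏ i, ρ (x i) (x (maskedPerm (leftWire n) Fin.rev b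
        (-(maskedPerm (leftWire n) Fin.rev (fun q => !b q) i))))
      = ∑ x : Fin (n + 1) → Fin d, ∏ i, ρ (x i) (x (i + 1)) := by
    intro b
    set U := (maskedPerm_involutive (leftWire n) hr b).toPerm with hU
    have hUi : ∀ i, maskedPerm (leftWire n) Fin.rev b i = U i := fun i => rfl
    rw [← (Equiv.arrowCongr U (Equiv.refl (Fin d))).sum_comp]
    refine Finset.sum_congr rfl fun x _ => ?_
    rw [← Equiv.prod_comp U]
    refine Finset.prod_congr rfl fun i _ => ?_
    have h1 : maskedPerm (leftWire n) Fin.rev (fun q => !b q) (U i) = Fin.rev i := by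
      have := maskedPerm_not (leftWire n) hr (fun q => !b q) i
      simp only [Bool.not_not] at this
      exact this
    rw [h1, neg_rev, hUi]
    simp [Equiv.arrowCongr]
  -- The masks before and after the flip are complementary, so the two inner partial reflections
  -- merge into negation by `maskedPerm_not`.
  have e4 : ∀ b : Fin ((n + 1) + (n + 1)) → Bool, ∀ x : Fin (n + 1) → Fin d,
      (tensorOp (fun _ => Matrix.of fun _ _ => (1 / 2 : ℂ)) (tensorPower (n + 1) ρ) :
        Operator ((n + 1) + (n + 1)) (n + 1) d) (b, x)
        ((maskedMap d (leftWire n) Fin.rev ∘ (maskedMap d (rightWire n) fun i => -i) ∘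
          (fun y => (fun q => !y.1 q, y.2)) ∘ (maskedMap d (rightWire n) fun i => -i) ∘
            maskedMap d (leftWire n) Fin.rev) (b, x))
      = (1 / 2 : ℂ) ^ ((n + 1) + (n + 1)) * ∏ i, ρ (x i) (x (maskedPerm (leftWire n) Fin.rev b
        (-(maskedPerm (leftWire n) Fin.rev (fun q => !b q) i)))) := by
    intro b x
    simp only [tensorOp, tensorPower, Matrix.of_apply, Finset.prod_const, Finset.card_univ,
      Fintype.card_fin, maskedMap, Function.comp_apply]
    congr 1
    refine Finset.prod_congr rfl fun i _ => ?_
    rw [maskedPerm_not (rightWire n) hn]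
  simp only [e4, ← Finset.mul_sum, e3]
  rw [Finset.sum_const, Finset.card_univ]
  simp only [Fintype.card_pi, Fintype.card_bool, Finset.prod_const, Finset.card_univ,
    Fintype.card_fin, nsmul_eq_mul]
  rw [← mul_assoc]
  push_cast
  rw [← mul_pow]
  norm_num

end CycleTest

/-! ### Spectra, reconstruction from low power sums, and the procedures. -/

section Estimation

/-- The nonnegative vectors of sum `1` with exactly `r` nonzero entries. -/
structure IsSpectrum {d : ℕ} (r : ℕ) (l : Fin d → ℝ) : Prop where
  nonneg : ∀ i, 0 ≤ l i
  sum_one : ∑ i, l i = 1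
  card_support : (Finset.univ.filter fun i => l i ≠ 0).card = r

lemma trace_cfc {d : ℕ} {ρ : Matrix (Fin d) (Fin d) ℂ} (hρ : ρ.IsHermitian) (g : ℝ → ℝ) :
    (cfc g ρ).trace = ((∑ i, g (hρ.eigenvalues i) : ℝ) : ℂ) := by
  rw [hρ.cfc_eq, Matrix.IsHermitian.cfc, Unitary.conjStarAlgAut_apply, Matrix.trace_mul_cycle,
    Unitary.coe_star_mul_self, one_mul, Matrix.trace_diagonal]
  simp

lemma IsDensity.exists_isSpectrum {d r : ℕ} {ρ : Matrix (Fin d) (Fin d) ℂ} (hρ : IsDensity ρ)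
    (hr : ρ.rank = r) : ∃ l : Fin d → ℝ, IsSpectrum r l ∧
      (∀ g : ℝ → ℝ, (cfc g ρ).trace = ((∑ i, g (l i) : ℝ) : ℂ)) ∧
      ∀ k, ((ρ ^ k).trace).re = ∑ i, l i ^ k := by
  have hH := hρ.posSemidef.isHermitian
  have hp : ∀ k, ((ρ ^ k).trace).re = ∑ i, hH.eigenvalues i ^ k := by
    intro k
    have hs : IsSelfAdjoint ρ := hH
    rw [← cfc_pow_id (R := ℝ) ρ k, trace_cfc hH, Complex.ofReal_re]
  refine ⟨hH.eigenvalues, ⟨hρ.posSemidef.eigenvalues_nonneg, ?_, ?_⟩, trace_cfc hH, hp⟩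
  · have := hp 1
    simpa [hρ.trace_one] using this.symm
  · rw [← hr, hH.rank_eq_card_non_zero_eigs, Fintype.card_subtype]

namespace IsSpectrum

variable {d r : ℕ} {l : Fin d → ℝ}

lemma le_one (h : IsSpectrum r l) (i : Fin d) : l i ≤ 1 := by
  rw [← h.sum_one]
  exact Finset.single_le_sum (fun j _ => h.nonneg j) (Finset.mem_univ i)

lemma sum_support_pow (l : Fin d → ℝ) {k : ℕ} (hk : 1 ≤ k) :
    ∑ i ∈ Finset.univ.filter (fun i => l i ≠ 0), l i ^ k = ∑ i, l i ^ k := by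
  refine Finset.sum_filter_of_ne fun i _ h h0 => h ?_
  rw [h0, zero_pow (by omega)]

lemma sum_pow_mem (h : IsSpectrum r l) {k : ℕ} (hk : 1 ≤ k) :
    0 ≤ ∑ i, l i ^ k ∧ ∑ i, l i ^ k ≤ 1 := by
  constructor
  · exact Finset.sum_nonneg fun i _ => pow_nonneg (h.nonneg i) k
  · rw [← h.sum_one]
    exact Finset.sum_le_sum fun i _ => pow_le_of_le_one (h.nonneg i) (h.le_one i) (by omega)

lemma sum_pow_eq_one_of_rank_one (h : IsSpectrum 1 l) {k : ℕ} (hk : 1 ≤ k) :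
    ∑ i, l i ^ k = 1 := by
  obtain ⟨i, hi⟩ := Finset.card_eq_one.1 h.card_support
  have h1 := sum_support_pow l le_rfl
  simp only [pow_one] at h1
  rw [h.sum_one, hi, Finset.sum_singleton] at h1
  rw [← sum_support_pow l hk, hi, Finset.sum_singleton, h1, one_pow]

/-- Replacing a function by a polynomial on the nonzero part of the spectrum. -/
lemma abs_sum_sub_lt (h : IsSpectrum r l) (hr : 1 ≤ r) {g : ℝ → ℝ} {c : ℕ → ℝ} {m : ℕ} {ε : ℝ}
    (hg : ∀ x ∈ Set.Icc (0 : ℝ) 1,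
      |g x - ∑ k ∈ Finset.range (m + 1), c k * x ^ k| < ε / (2 * (r : ℝ))) :
    |∑ i, g (l i) - (((d : ℝ) - r) * g 0 + r * c 0
      + ∑ k ∈ Finset.range m, c (k + 1) * ∑ i, l i ^ (k + 1))| < ε / 2 := by
  set s := Finset.univ.filter fun i => l i ≠ 0 with hs
  have hcard : s.card = r := h.card_support
  -- The rank is known exactly, so the kernel contributes a known constant and only `r` eigenvalues
  -- incur the approximation error `ε / (2 r)`.
  have h0 : ∑ i ∈ Finset.univ.filter (fun i => ¬ l i ≠ 0), g (l i) = ((d : ℝ) - r) * g 0 := by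
    rw [Finset.sum_congr rfl (g := fun _ => g 0) fun i hi => by
      rw [not_not.1 (Finset.mem_filter.1 hi).2], Finset.sum_const, nsmul_eq_mul]
    congr 1
    have := Finset.card_filter_add_card_filter_not (s := Finset.univ) fun i => l i ≠ 0
    rw [← hs, hcard, Finset.card_univ, Fintype.card_fin] at this
    rw [eq_sub_iff_add_eq']
    exact_mod_cast this
  have hpoly : ∑ i ∈ s, ∑ k ∈ Finset.range (m + 1), c k * l i ^ k
      = r * c 0 + ∑ k ∈ Finset.range m, c (k + 1) * ∑ i, l i ^ (k + 1) := by
    simp only [Finset.sum_range_succ', pow_zero, mul_one]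
    rw [Finset.sum_add_distrib, Finset.sum_const, hcard, nsmul_eq_mul, add_comm,
      Finset.sum_comm]
    congr 1
    refine Finset.sum_congr rfl fun k _ => ?_
    rw [← Finset.mul_sum, sum_support_pow l (by omega)]
  have e : ∑ i, g (l i) - (((d : ℝ) - r) * g 0 + r * c 0
      + ∑ k ∈ Finset.range m, c (k + 1) * ∑ i, l i ^ (k + 1))
      = ∑ i ∈ s, (g (l i) - ∑ k ∈ Finset.range (m + 1), c k * l i ^ k) := by
    rw [Finset.sum_sub_distrib, hpoly, ← h0,
      ← Finset.sum_filter_add_sum_filter_not Finset.univ (fun i => l i ≠ 0) fun i => g (l i)]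
    ring
  have hr' : (0 : ℝ) < r := by exact_mod_cast hr
  rw [e]
  refine (Finset.abs_sum_le_sum_abs _ _).trans_lt ?_
  have hne : s.Nonempty := Finset.card_pos.1 (by omega)
  refine (Finset.sum_lt_sum_of_nonempty hne fun i _ =>
    hg _ ⟨h.nonneg i, h.le_one i⟩).trans_eq ?_
  rw [Finset.sum_const, hcard, nsmul_eq_mul]
  field_simp

/-- The power sums of degree up to `10 q` determine those of degree up to `m`. -/
lemma abs_sum_pow_sub_le {l' : Fin d → ℝ} (h : IsSpectrum r l) (h' : IsSpectrum r l') {m q : ℕ}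
    {ε C : ℝ} (hε : 0 < ε) (hC : 0 < C) (hm : 1 ≤ m) (hq : 2 ≤ q)
    (hlow : Real.exp q ≤ 4 * m * C / ε)
    (hup : r ≤ 10 * q ∨ 4 * m * C / ε ≤ Real.exp (q + 1))
    (hp : ∀ j, 1 ≤ j → j ≤ 10 * q →
      |∑ i, l i ^ j - ∑ i, l' i ^ j| ≤ 2 * (ε / (600 * C * m * (10 * q : ℕ))))
    {k : ℕ} (hk : 1 ≤ k) (hkm : k ≤ m) :
    |∑ i, l i ^ k - ∑ i, l' i ^ k| ≤ ε / (2 * C) := by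
  have hm' : (1 : ℝ) ≤ m := by exact_mod_cast hm
  have hq' : (2 : ℝ) ≤ q := by exact_mod_cast hq
  have hkm' : (k : ℝ) ≤ m := by exact_mod_cast hkm
  have he := Real.exp_one_lt_d9
  have he0 := Real.exp_pos 1
  have hmC : 0 < m * C := by positivity
  set η := 2 * (ε / (600 * C * m * (10 * q : ℕ))) with hη
  have hη0 : 0 ≤ η := by positivity
  have hηR : η * (10 * q : ℕ) = ε / (300 * (m * C)) := by
    rw [hη]; push_cast; field_simp; norm_num
  have hsmall : ε / (m * C) ≤ 4 := by
    have h1 : (1 : ℝ) ≤ Real.exp q := Real.one_le_exp (by positivity)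
    have h2 := h1.trans hlow
    rw [le_div_iff₀ hε] at h2
    rw [div_le_iff₀ hmC]
    linarith
  have hηR' : η * (10 * q : ℕ) = ε / (m * C) / 300 := by
    rw [hηR]; field_simp
  -- If `r ≤ 10 q`, the polynomial `E` has degree at most `10 q` and there is no tail. Otherwise the
  -- tail bound is used with weight `s = e`.
  have tail : ∀ {v : Fin d → ℝ}, IsSpectrum r v →
      ∑ j ∈ Finset.Ioc (10 * q) k, |PowerSeries.coeff j
        (eulerOp (elemSeries (Finset.univ.filter fun i => v i ≠ 0) v))| ≤ ε / (m * C) / 40 := by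
    intro v hv
    rcases hup with hup | hup
    · rw [Finset.sum_eq_zero]
      · positivity
      · intro j hj
        have := (Finset.mem_Ioc.1 hj).1
        rw [coeff_eulerOp, coeff_elemSeries_eq_zero _ _ (by rw [hv.card_support]; omega), mul_zero,
          abs_zero]
    · have h1 := sum_support_pow v le_rfl
      simp only [pow_one] at h1
      rw [hv.sum_one] at h1
      refine (sum_tail_elemSeries_le _ (fun i _ => hv.nonneg i) h1 (10 * q) k
        (Real.one_le_exp zero_le_one)).trans ?_
      rw [← Real.exp_add, ← Real.exp_nat_mul, ← Real.exp_sub]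
      have h2 : Real.exp (-(q + 1)) ≤ ε / (m * C) / 4 := by
        rw [Real.exp_neg, inv_le_comm₀ (Real.exp_pos _) (by positivity)]
        refine le_trans (le_of_eq ?_) hup
        field_simp
      have h3 : Real.exp (-13) ≤ 1 / 10 := by
        have := Real.add_one_le_exp (13 : ℝ)
        rw [Real.exp_neg, inv_le_comm₀ (Real.exp_pos _) (by norm_num)]
        linarith
      -- This amounts to `15 + e ≤ 9 q`, which holds from `q = 2` on; it is the reason for the
      -- factor `10`.
      have h4 : Real.exp (1 + Real.exp 1 - (10 * q : ℕ) * 1)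
          ≤ Real.exp (-(q + 1)) * Real.exp (-13) := by
        rw [← Real.exp_add]
        refine Real.exp_le_exp.2 ?_
        push_cast
        linarith
      refine h4.trans ((mul_le_mul h2 h3 (Real.exp_nonneg _) (by positivity)).trans_eq ?_)
      ring
  have s1 := sum_support_pow l le_rfl
  have s2 := sum_support_pow l' le_rfl
  simp only [pow_one] at s1 s2
  rw [h.sum_one] at s1
  rw [h'.sum_one] at s2
  have key := abs_powerSum_sub_le _ _ (fun i _ => h.nonneg i) s1 (fun i _ => h'.nonneg i) s2
    (R := 10 * q) hη0 (by rw [hηR']; linarith) hk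
    (fun j hj hjR => by rw [sum_support_pow l hj, sum_support_pow l' hj]; exact hp j hj hjR)
    (tail h) (tail h')
  rw [sum_support_pow l hk, sum_support_pow l' hk, hηR'] at key
  refine key.trans ?_
  have e1 : ε / (2 * C) = ε / (m * C) * m / 2 := by field_simp
  rw [e1]
  set y := ε / (m * C)
  have hy : 0 ≤ y := by positivity
  have he2 : Real.exp 1 * Real.exp 1 ≤ 7.4 := by nlinarith
  -- The constants `600` and `40` are chosen for this: `8 e² / 300 + e / 10` is about `0.47`.
  have b : 2 * Real.exp 1 * (4 * Real.exp 1 * (y / 300) + 2 * (y / 40)) ≤ y / 2 := by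
    nlinarith [mul_le_mul_of_nonneg_right he2 hy, mul_le_mul_of_nonneg_right he.le hy]
  calc 2 * Real.exp 1 * k * (4 * Real.exp 1 * (y / 300) + 2 * (y / 40))
      = k * (2 * Real.exp 1 * (4 * Real.exp 1 * (y / 300) + 2 * (y / 40))) := by ring
    _ ≤ m * (y / 2) := mul_le_mul hkm' b (by positivity) (by positivity)
    _ = y * m / 2 := by ring

end IsSpectrum

lemma abs_sum_mul_le {c u : ℕ → ℝ} {m : ℕ} {C B : ℝ} (hB : 0 ≤ B)
    (hc : ∑ k ∈ Finset.range (m + 1), |c k| < C) (hu : ∀ k < m, |u k| ≤ B) :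
    |∑ k ∈ Finset.range m, c (k + 1) * u k| ≤ C * B := by
  rw [Finset.sum_range_succ'] at hc
  calc |∑ k ∈ Finset.range m, c (k + 1) * u k|
      ≤ ∑ k ∈ Finset.range m, |c (k + 1)| * B := by
        refine (Finset.abs_sum_le_sum_abs _ _).trans (Finset.sum_le_sum fun k hk => ?_)
        rw [abs_mul]
        exact mul_le_mul_of_nonneg_left (hu k (Finset.mem_range.1 hk)) (abs_nonneg _)
    _ = (∑ k ∈ Finset.range m, |c (k + 1)|) * B := (Finset.sum_mul _ _ _).symm
    _ ≤ C * B := mul_le_mul_of_nonneg_right (by linarith [abs_nonneg (c 0)]) hB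

/-- The procedure that uses no copies of the state and outputs `v`. -/
noncomputable def constProcedure (v : ℝ) : Procedure where
  runs := 0
  circuit i := i.elim0
  estimate _ := v

lemma constProcedure_successProb {d : ℕ} (ρ : Matrix (Fin d) (Fin d) ℂ) {v x ε : ℝ}
    (h : |v - x| < ε) : (constProcedure v).successProb ρ (x : ℂ) ε = 1 := by
  have h' : ‖((v : ℝ) : ℂ) - x‖ < ε := by
    rw [← Complex.ofReal_sub, Complex.norm_real]; exact h
  refine (Finset.sum_congr (Finset.filter_true_of_mem fun ω _ => h') fun _ _ => rfl).trans ?_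
  have hprod : ∀ ω : (∀ i, ((constProcedure v).circuit i).Outcome),
      ∏ i, ((constProcedure v).circuit i).prob ρ (ω i) = 1 := fun ω =>
    Finset.prod_of_isEmpty (ι := Fin 0) _
  refine (Finset.sum_congr rfl fun ω _ => hprod ω).trans ?_
  rw [Finset.sum_const, Finset.card_univ]
  have : Fintype.card (∀ i, ((constProcedure v).circuit i).Outcome) = 1 :=
    Fintype.card_eq_one_iff.2 ⟨fun i => i.elim0, fun f => funext fun i => i.elim0⟩
  rw [this, one_smul]

/-- The procedure that runs the cycle test `N` times for each power from `1` to `R`. -/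
noncomputable def cycleProcedure (R N : ℕ)
    (est : (∀ i : Fin (R * N), (cycleTest (finProdFinEquiv.symm i).1).Outcome) → ℝ) :
    Procedure where
  runs := R * N
  circuit i := cycleTest (finProdFinEquiv.symm i).1
  estimate := est

/-- The runs for the power `t + 1`. -/
def powerRuns (R N : ℕ) (t : Fin R) : Finset (Fin (R * N)) :=
  Finset.univ.filter fun i => (finProdFinEquiv.symm i).1 = t

lemma card_powerRuns (R N : ℕ) (t : Fin R) : (powerRuns R N t).card = N := by
  rw [powerRuns, ← Fintype.card_subtype,
    Fintype.card_congr (finProdFinEquiv.symm.subtypeEquiv (p := fun i =>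
      (finProdFinEquiv.symm i).1 = t) (q := fun p : Fin R × Fin N => p.1 = t) fun i => Iff.rfl)]
  rw [Fintype.card_subtype, show (Finset.univ.filter fun p : Fin R × Fin N => p.1 = t)
    = {t} ×ˢ Finset.univ by ext ⟨a, b⟩; simp [eq_comm]]
  simp

lemma cycleProcedure_copies_le (R N : ℕ) (est) : (cycleProcedure R N est).copies ≤ R * N * R := by
  refine (Finset.sum_le_card_nsmul _ _ R fun i _ => ?_).trans_eq ?_
  · exact (finProdFinEquiv.symm i).1.isLt
  · rw [Finset.card_univ, smul_eq_mul]
    exact congrArg (· * R) (Fintype.card_fin (R * N))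

/-- The average parity sign of the runs for the power `t + 1`. -/
noncomputable def averageSign {R N : ℕ}
    (ω : ∀ i : Fin (R * N), (cycleTest (finProdFinEquiv.symm i).1).Outcome) (t : Fin R) : ℝ :=
  (∑ i ∈ powerRuns R N t, paritySign (ω i)) / N

lemma cycleProcedure_successProb {d R N : ℕ} (hN : 0 < N) {ρ : Matrix (Fin d) (Fin d) ℂ}
    (hρ : IsDensity ρ) (est) {x ε η : ℝ} (hη : 0 ≤ η) (hη4 : η ≤ 4)
    (hest : ∀ ω, (∀ t : Fin R, |averageSign (N := N) ω t - ((ρ ^ (t.val + 1)).trace).re| ≤ η) →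
      |est ω - x| < ε) :
    1 - R * (2 * Real.exp (-(N * η ^ 2 / 16))) ≤ (cycleProcedure R N est).successProb ρ x ε := by
  set A := cycleProcedure R N est with hA
  have h := @one_sub_le_prob_means (Fin A.runs) _ _ (fun i => (A.circuit i).Outcome) _ (Fin R) _
    (fun i => (A.circuit i).prob ρ) (fun _ ω => paritySign ω)
    (fun t : Fin R => ((ρ ^ (t.val + 1)).trace).re)
    (fun i c => cycleTest_prob_nonneg _ hρ c) (fun i => cycleTest_sum_prob _ hρ)
    (fun i c => (abs_paritySign c).le) (powerRuns R N)
    (fun t i hi => by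
      rw [← (Finset.mem_filter.1 hi).2]
      exact cycleTest_expectation _ ρ)
    N hN (card_powerRuns R N) η hη hη4 (fun ω => ‖((A.estimate ω : ℝ) : ℂ) - x‖ < ε)
    (fun _ => Classical.propDecidable _)
    (fun ω hω => by
      rw [← Complex.ofReal_sub, Complex.norm_real]
      exact hest ω hω)
  rw [Fintype.card_fin] at h
  exact h

open Classical in
/-- Evaluates the functional `F` at some spectrum that is consistent with the observed averages. -/
noncomputable def consistentEstimate (d r : ℕ) {R N : ℕ} (η : ℝ) (F : (Fin d → ℝ) → ℝ)
    (ω : ∀ i : Fin (R * N), (cycleTest (finProdFinEquiv.symm i).1).Outcome) : ℝ :=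
  if h : ∃ l : Fin d → ℝ, IsSpectrum r l ∧
      ∀ t : Fin R, |averageSign ω t - ∑ i, l i ^ (t.val + 1)| ≤ η
  then F h.choose else 0

/-- The true spectrum is itself consistent, so the default value is not used, and two consistent
spectra have power sums within `2 η` of each other. -/
lemma abs_consistentEstimate_sub_le {d r R N : ℕ} {η B : ℝ} {F : (Fin d → ℝ) → ℝ}
    {ω : ∀ i : Fin (R * N), (cycleTest (finProdFinEquiv.symm i).1).Outcome} {l : Fin d → ℝ}
    (hl : IsSpectrum r l)
    (hω : ∀ t : Fin R, |averageSign ω t - ∑ i, l i ^ (t.val + 1)| ≤ η)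
    (hF : ∀ l' : Fin d → ℝ, IsSpectrum r l' →
      (∀ j, 1 ≤ j → j ≤ R → |∑ i, l i ^ j - ∑ i, l' i ^ j| ≤ 2 * η) → |F l' - F l| ≤ B) :
    |consistentEstimate d r η F ω - F l| ≤ B := by
  have h : ∃ l : Fin d → ℝ, IsSpectrum r l ∧
      ∀ t : Fin R, |averageSign ω t - ∑ i, l i ^ (t.val + 1)| ≤ η := ⟨l, hl, hω⟩
  rw [consistentEstimate, dif_pos h]
  refine hF _ h.choose_spec.1 fun j hj hjR => ?_
  have h1 := hω ⟨j - 1, by omega⟩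
  have h2 := h.choose_spec.2 ⟨j - 1, by omega⟩
  simp only [Nat.sub_add_cancel hj] at h1 h2
  rw [abs_le] at h1 h2 ⊢
  constructor <;> linarith [h1.1, h1.2, h2.1, h2.2]

end Estimation

/-! ### Sample size and polylogarithmic bounds. -/

section Resources

/-- The number of runs per power, and the resulting bounds. -/
lemma sample_size_bounds {q m : ℕ} {ε δ C : ℝ} (hε : 0 < ε) (hδ : 0 < δ) (hδ1 : δ < 1)
    (hC : 0 < C) (hm : 1 ≤ m) (hq : 2 ≤ q) (hlow : Real.exp q ≤ 4 * m * C / ε) :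
    ∃ N : ℕ, 0 < N ∧
      ((10 * q : ℕ) : ℝ) *
        (2 * Real.exp (-(N * (ε / (600 * C * m * (10 * q : ℕ))) ^ 2 / 16))) ≤ δ ∧
      (N : ℝ) ≤ 10 ^ 10 * (C ^ 2 * (m : ℝ) ^ 2 * (q : ℝ) ^ 2 * Real.log q ^ 2 / ε ^ 2) *
        Real.log (2 / δ) := by
  have hm' : (1 : ℝ) ≤ m := by exact_mod_cast hm
  have hq' : (2 : ℝ) ≤ q := by exact_mod_cast hq
  have hl2 := Real.log_two_gt_d9
  set D := Real.log (2 / δ) with hD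
  have hDl : Real.log 2 ≤ D := Real.log_le_log (by norm_num) (by rw [le_div_iff₀ hδ]; linarith)
  have hql : Real.log 2 ≤ Real.log q := Real.log_le_log (by norm_num) hq'
  set R : ℝ := ((10 * q : ℕ) : ℝ) with hR
  have hRq : R = 10 * q := by rw [hR]; push_cast; rfl
  have hR0 : 0 < R := by rw [hRq]; linarith
  set η := ε / (600 * C * m * R) with hη
  have hη0 : 0 < η := by positivity
  set L := Real.log (2 * R / δ) with hL
  have hLe : L = Real.log R + D := by
    rw [hL, hD, ← Real.log_mul (by positivity) (by positivity)]
    congr 1; ring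
  have hlogR : Real.log R ≤ 5 * Real.log q := by
    have h10 : Real.log 10 ≤ 4 * Real.log 2 := by
      rw [show (4 : ℝ) * Real.log 2 = Real.log (2 ^ 4) by rw [Real.log_pow]; norm_num]
      exact Real.log_le_log (by norm_num) (by norm_num)
    rw [hRq, Real.log_mul (by norm_num) (by positivity)]
    linarith
  set v := Real.log q with hv
  have hv0 : 0.69 ≤ v := by linarith
  have hD0 : 0.69 ≤ D := by linarith
  have hvD : v * 0.69 ≤ v * D := mul_le_mul_of_nonneg_left hD0 (by linarith)
  have hvvD : v * D * 0.69 ≤ v * D * v := mul_le_mul_of_nonneg_left hv0 (by nlinarith)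
  -- Both `v` and `D` are at least `0.69`, so `5 v + D` is absorbed into the product; this uses `q ≥
  -- 2`, which keeps `log q` away from zero.
  have hLb : L ≤ 13 * (v ^ 2 * D) := by
    have h3 : 0.69 * D ≤ v * D := mul_le_mul_of_nonneg_right hv0 (by linarith)
    rw [hLe]
    nlinarith
  have hL0 : 0 < L := by
    have : 0 ≤ Real.log R := Real.log_nonneg (by rw [hRq]; linarith)
    linarith
  set y := C * m / ε with hy
  have hy1 : 1 ≤ y := by
    have h1 : (7 : ℝ) ≤ 4 * m * C / ε := by
      refine le_trans ?_ hlow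
      have h2 : Real.exp 2 ≤ Real.exp q := Real.exp_le_exp.2 hq'
      have h3 : Real.exp 2 = Real.exp 1 * Real.exp 1 := by rw [← Real.exp_add]; norm_num
      have := Real.exp_one_gt_d9
      nlinarith
    have h2 : 4 * m * C / ε = 4 * y := by rw [hy]; ring
    linarith
  have hη2 : 16 / η ^ 2 = 576000000 * (y * q) ^ 2 := by
    rw [hη, hRq, hy]; field_simp; norm_num
  -- With this many runs `N η ^ 2 / 16 ≥ log (2 R / δ)`, so each of the `2 R` one-sided deviations
  -- has probability at most `δ / (2 R)`.
  refine ⟨⌈16 / η ^ 2 * L⌉₊, Nat.ceil_pos.2 (by positivity), ?_, ?_⟩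
  · have h1 := Nat.le_ceil (16 / η ^ 2 * L)
    set N := ⌈16 / η ^ 2 * L⌉₊
    have h2 : L ≤ N * η ^ 2 / 16 := by
      calc L = 16 / η ^ 2 * L * η ^ 2 / 16 := by field_simp
        _ ≤ _ := by gcongr
    have h3 : Real.exp (-(N * η ^ 2 / 16)) ≤ δ / (2 * R) := by
      refine (Real.exp_le_exp.2 (neg_le_neg h2)).trans_eq ?_
      rw [Real.exp_neg, hL, Real.exp_log (by positivity), inv_div]
    calc R * (2 * Real.exp (-(N * η ^ 2 / 16))) ≤ R * (2 * (δ / (2 * R))) := by gcongr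
      _ = δ := by field_simp
  · have h1 := (Nat.ceil_lt_add_one (show 0 ≤ 16 / η ^ 2 * L by positivity)).le
    rw [hη2] at h1
    rw [hη2]
    have e : C ^ 2 * (m : ℝ) ^ 2 * (q : ℝ) ^ 2 * v ^ 2 / ε ^ 2 = (y * q) ^ 2 * v ^ 2 := by
      rw [hy]; field_simp
    rw [e]
    have hyq' : 1 * 2 ≤ y * q := mul_le_mul hy1 hq' (by norm_num) (by linarith)
    have hyq : 4 ≤ (y * q) ^ 2 := by nlinarith
    have h2 : (y * q) ^ 2 * L ≤ (y * q) ^ 2 * (13 * (v ^ 2 * D)) :=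
      mul_le_mul_of_nonneg_left hLb (by positivity)
    have h3 : 0.32 ≤ v ^ 2 * D := by nlinarith
    have h4 : 4 * 0.32 ≤ (y * q) ^ 2 * (v ^ 2 * D) :=
      mul_le_mul hyq h3 (by norm_num) (by positivity)
    have e2 : 10 ^ 10 * ((y * q) ^ 2 * v ^ 2) * D = 10 ^ 10 * ((y * q) ^ 2 * (v ^ 2 * D)) := by
      ring
    rw [e2]
    linarith

/-- Combines `log q ≤ q` with `4 y ≤ (2 + y) ^ 2`; the sixth power comes from `q ^ 4 · q ^ 2`. -/
lemma effectiveRank_pow_mul_log_sq_le {q : ℕ} {y : ℝ} (hq : 1 ≤ q) (hy : 0 < y)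
    (hqy : (q : ℝ) ≤ Real.log (4 * y)) :
    (q : ℝ) ^ 4 * Real.log q ^ 2 ≤ 64 * Real.log (2 + y) ^ 6 := by
  have hq' : (1 : ℝ) ≤ q := by exact_mod_cast hq
  have h1 : Real.log (4 * y) ≤ 2 * Real.log (2 + y) := by
    rw [show 2 * Real.log (2 + y) = Real.log ((2 + y) ^ 2) by rw [Real.log_pow]; norm_num]
    exact Real.log_le_log (by positivity) (by nlinarith [sq_nonneg y])
  have h2 : Real.log q ≤ q := (Real.log_le_sub_one_of_pos (by linarith)).trans (by linarith)
  have h3 := Real.log_nonneg hq'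
  calc (q : ℝ) ^ 4 * Real.log q ^ 2 ≤ (q : ℝ) ^ 4 * (q : ℝ) ^ 2 := by gcongr
    _ = (q : ℝ) ^ 6 := by ring
    _ ≤ (2 * Real.log (2 + y)) ^ 6 := by gcongr; linarith
    _ = _ := by ring

end Resources

/-! ### Assembly: trivial and nontrivial effective rank. -/

section Main

/-- With effective rank at most `1`, the estimate is known in advance. -/
lemma exists_constant_estimate {d r m : ℕ} {ε C : ℝ} {g : ℝ → ℝ} {c : ℕ → ℝ} (hε : 0 < ε)
    (hg : ∀ x ∈ Set.Icc (0 : ℝ) 1,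
      |g x - ∑ k ∈ Finset.range (m + 1), c k * x ^ k| < ε / (2 * (r : ℝ)))
    (hc : ∑ k ∈ Finset.range (m + 1), |c k| < C)
    (hq : effectiveRank r m (ε / (2 * C)) ≤ 1) :
    ∃ v : ℝ, ∀ l : Fin d → ℝ, IsSpectrum r l → |v - ∑ i, g (l i)| < ε := by
  have hC : 0 < C := (Finset.sum_nonneg fun _ _ => abs_nonneg _).trans_lt hc
  -- For `r = 0` the approximation bound `ε / (2 r)` is `0` in Lean, and the strict inequality at `x
  -- = 0` is impossible.
  have hr : 1 ≤ r := by
    by_contra h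
    have h0 : r = 0 := by omega
    have := hg 0 ⟨le_rfl, zero_le_one⟩
    rw [h0, Nat.cast_zero, mul_zero, div_zero] at this
    exact absurd this (abs_nonneg _).not_gt
  suffices h : ∃ w : ℕ → ℝ, ∀ l : Fin d → ℝ, IsSpectrum r l →
      |∑ k ∈ Finset.range m, c (k + 1) * (w k - ∑ i, l i ^ (k + 1))| ≤ ε / 2 by
    obtain ⟨w, hw⟩ := h
    refine ⟨((d : ℝ) - r) * g 0 + r * c 0 + ∑ k ∈ Finset.range m, c (k + 1) * w k,
      fun l hl => ?_⟩
    have h1 := abs_lt.1 (hl.abs_sum_sub_lt hr hg)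
    have h2 := abs_le.1 (hw l hl)
    simp only [mul_sub, Finset.sum_sub_distrib] at h2
    rw [abs_lt]
    constructor <;> linarith [h1.1, h1.2, h2.1, h2.2]
  rcases Nat.lt_or_ge r 2 with hr2 | hr2
  · obtain rfl : r = 1 := by omega
    refine ⟨fun _ => 1, fun l hl => ?_⟩
    rw [Finset.sum_eq_zero]
    · rw [abs_zero]; positivity
    · intro k _
      rw [hl.sum_pow_eq_one_of_rank_one (by omega), sub_self, mul_zero]
  -- Index `0` is the trace, which equals `1`; every higher power sum lies in `[0, 1]`, so the
  -- midpoint is off by at most `1 / 2`.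
  · refine ⟨fun k => if k = 0 then 1 else 1 / 2, fun l hl => ?_⟩
    rcases Nat.lt_or_ge m 2 with hm | hm
    · rw [Finset.sum_eq_zero]
      · rw [abs_zero]; positivity
      · intro k hk
        have : k = 0 := by have := Finset.mem_range.1 hk; omega
        subst this
        simp [hl.sum_one]
    · have hm' : (2 : ℝ) ≤ m := by exact_mod_cast hm
      have hlog : Real.log (2 * (m : ℝ) / (ε / (2 * C))) < 2 := by
        have h1 : ⌊Real.log (2 * (m : ℝ) / (ε / (2 * C)))⌋₊ ≤ 1 := by
          rw [effectiveRank] at hq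
          omega
        have h2 := Nat.lt_floor_add_one (Real.log (2 * (m : ℝ) / (ε / (2 * C))))
        have h3 : ((⌊Real.log (2 * (m : ℝ) / (ε / (2 * C)))⌋₊ : ℕ) : ℝ) ≤ 1 := by
          exact_mod_cast h1
        linarith
      -- From `4 m C / ε < e ^ 2 < 8` and `m ≥ 2`. An error of `1 / 2` per power sum then costs at
      -- most `C / 2 ≤ ε / 2`.
      have hCε : C ≤ ε := by
        rw [Real.log_lt_iff_lt_exp (by positivity), div_lt_iff₀ (by positivity)] at hlog
        have h3 : Real.exp 2 = Real.exp 1 * Real.exp 1 := by rw [← Real.exp_add]; norm_num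
        have h4 : Real.exp 2 ≤ 8 := by nlinarith [Real.exp_one_lt_d9, Real.exp_pos 1]
        have h5 : 2 * (m : ℝ) < 8 * (ε / (2 * C)) :=
          hlog.trans_le (mul_le_mul_of_nonneg_right h4 (by positivity))
        have h6 : 4 < 8 * (ε / (2 * C)) := by linarith
        rw [← mul_div_assoc, lt_div_iff₀ (by positivity)] at h6
        linarith
      refine (abs_sum_mul_le (B := 1 / 2) (by norm_num) hc fun k _ => ?_).trans (by linarith)
      dsimp only
      split_ifs with hk
      · subst hk; simp [hl.sum_one]
      · have := hl.sum_pow_mem (k := k + 1) (by omega)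
        rw [abs_le]
        constructor <;> linarith [this.1, this.2]

/-- With effective rank at least `2`, the power sums up to ten times the effective rank are
estimated. -/
lemma exists_procedure_of_two_le {d r m : ℕ} {ε δ C : ℝ} {g : ℝ → ℝ} {c : ℕ → ℝ} (hε : 0 < ε)
    (hδ : 0 < δ) (hδ1 : δ < 1)
    (hg : ∀ x ∈ Set.Icc (0 : ℝ) 1,
      |g x - ∑ k ∈ Finset.range (m + 1), c k * x ^ k| < ε / (2 * (r : ℝ)))
    (hc : ∑ k ∈ Finset.range (m + 1), |c k| < C)
    (hq : 2 ≤ effectiveRank r m (ε / (2 * C))) :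
    ∃ N : ℕ, ∃ est, (N : ℝ) ≤ 10 ^ 10 * (C ^ 2 * (m : ℝ) ^ 2 *
        (effectiveRank r m (ε / (2 * C)) : ℝ) ^ 2 *
        Real.log (effectiveRank r m (ε / (2 * C)) : ℝ) ^ 2 / ε ^ 2) * Real.log (2 / δ) ∧
      (effectiveRank r m (ε / (2 * C)) : ℝ) ≤ Real.log (4 * (C * m / ε)) ∧
      ∀ ρ : Matrix (Fin d) (Fin d) ℂ, IsDensity ρ → ρ.rank = r →
        1 - δ ≤ (cycleProcedure (10 * effectiveRank r m (ε / (2 * C))) N est).successProb ρ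
          (cfc g ρ).trace ε := by
  have hC : 0 < C := (Finset.sum_nonneg fun _ _ => abs_nonneg _).trans_lt hc
  have hx : 2 * (m : ℝ) / (ε / (2 * C)) = 4 * m * C / ε := by field_simp; ring
  set q := effectiveRank r m (ε / (2 * C)) with hqdef
  rw [effectiveRank, hx] at hqdef
  have hqr : q ≤ r := by omega
  have hql : q ≤ ⌊Real.log (4 * m * C / ε)⌋₊ := by omega
  have hr : 1 ≤ r := by omega
  -- For `m = 0` the convention `Real.log 0 = 0` makes the effective rank vanish.
  have hm : 1 ≤ m := by
    by_contra h
    have h0 : m = 0 := by omega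
    rw [h0] at hql
    simp at hql
    omega
  have hm' : (1 : ℝ) ≤ m := by exact_mod_cast hm
  have hxpos : 0 < 4 * m * C / ε := by positivity
  have hqlog : (q : ℝ) ≤ Real.log (4 * m * C / ε) := by
    rw [Nat.le_floor_iff' (by omega)] at hql
    exact hql
  have hlow : Real.exp q ≤ 4 * m * C / ε := (Real.le_log_iff_exp_le hxpos).1 hqlog
  -- Whichever term attains the minimum in the effective rank controls the tail: the rank by degree,
  -- the logarithm by decay.
  have hup : r ≤ 10 * q ∨ 4 * m * C / ε ≤ Real.exp (q + 1) := by
    rcases Nat.lt_or_ge q r with h | h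
    · right
      have h1 : q = ⌊Real.log (4 * m * C / ε)⌋₊ := by omega
      have h2 := (Nat.lt_floor_add_one (Real.log (4 * m * C / ε))).le
      rw [← h1] at h2
      exact (Real.log_le_iff_le_exp hxpos).1 h2
    · left; omega
  obtain ⟨N, hN, hprob, hNle⟩ := sample_size_bounds hε hδ hδ1 hC hm hq hlow
  set η := ε / (600 * C * m * (10 * q : ℕ)) with hη
  have hη0 : 0 ≤ η := by positivity
  have hη4 : η ≤ 4 := by
    have h1 : (1 : ℝ) ≤ 4 * m * C / ε := (Real.one_le_exp (Nat.cast_nonneg q)).trans hlow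
    rw [le_div_iff₀ hε] at h1
    rw [hη, div_le_iff₀ (by positivity)]
    have h2 : (1 : ℝ) ≤ ((10 * q : ℕ) : ℝ) := by exact_mod_cast (by omega : 1 ≤ 10 * q)
    have h3 : C * m * 1 ≤ C * m * ((10 * q : ℕ) : ℝ) :=
      mul_le_mul_of_nonneg_left h2 (by positivity)
    nlinarith
  set F : (Fin d → ℝ) → ℝ := fun l => ((d : ℝ) - r) * g 0 + r * c 0
    + ∑ k ∈ Finset.range m, c (k + 1) * ∑ i, l i ^ (k + 1) with hF
  refine ⟨N, consistentEstimate d r η F, hNle, ?_, fun ρ hρ hrank => ?_⟩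
  · rwa [show 4 * (C * m / ε) = 4 * m * C / ε by ring]
  · obtain ⟨l, hl, hcfc, hpow⟩ := hρ.exists_isSpectrum hrank
    rw [hcfc]
    refine le_trans (by linarith) (cycleProcedure_successProb hN hρ _ hη0 hη4 fun ω hω => ?_)
    simp only [hpow] at hω
    have h1 := abs_consistentEstimate_sub_le (F := F) (B := ε / 2) hl hω fun l' hl' hp => by
      have e : F l' - F l
          = ∑ k ∈ Finset.range m, c (k + 1) * (∑ i, l' i ^ (k + 1) - ∑ i, l i ^ (k + 1)) := by
        simp only [hF, mul_sub, Finset.sum_sub_distrib]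
        ring
      rw [e]
      refine (abs_sum_mul_le (B := ε / (2 * C)) (by positivity) hc fun k hk => ?_).trans_eq
        (by field_simp)
      rw [abs_sub_comm]
      exact hl.abs_sum_pow_sub_le hl' hε hC hm hq hlow hup hp (by omega) (by omega)
    have h2 := hl.abs_sum_sub_lt hr hg
    have h3 := abs_sub_le (consistentEstimate d r η F ω) (F l) (∑ i, g (l i))
    rw [abs_sub_comm] at h2
    linarith

end Main

theorem theorem4 :
    ∃ K : ℝ, ∀ (d r m : ℕ) (ε δ C : ℝ) (g : ℝ → ℝ) (c : ℕ → ℝ),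
      0 < ε → 0 < δ → δ < 1 →
      (∀ x ∈ Set.Icc (0 : ℝ) 1,
        |g x - ∑ k ∈ Finset.range (m + 1), c k * x ^ k| < ε / (2 * (r : ℝ))) →
      ∑ k ∈ Finset.range (m + 1), |c k| < C →
      ∃ A : Procedure,
        -- correctness on every state of rank `r`
        (∀ ρ : Matrix (Fin d) (Fin d) ℂ, IsDensity ρ → ρ.rank = r →
          1 - δ ≤ A.successProb ρ (cfc g ρ).trace ε) ∧
        -- number of copies
        (A.copies : ℝ) ≤ K * (C ^ 2 * (m : ℝ) ^ 2 *
          (effectiveRank r m (ε / (2 * C)) : ℝ) ^ 4 *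
          Real.log (effectiveRank r m (ε / (2 * C)) : ℝ) ^ 2 / ε ^ 2) * Real.log (2 / δ) ∧
        (A.copies : ℝ) ≤ K * (C ^ 2 * (m : ℝ) ^ 2 / ε ^ 2) *
          Real.log (2 + C * (m : ℝ) / ε) ^ 6 * Real.log (2 / δ) ∧
        -- number of runs
        (A.runs : ℝ) ≤ K * (C ^ 2 * (m : ℝ) ^ 2 *
          (effectiveRank r m (ε / (2 * C)) : ℝ) ^ 3 *
          Real.log (effectiveRank r m (ε / (2 * C)) : ℝ) ^ 2 / ε ^ 2) * Real.log (2 / δ) ∧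
        (A.runs : ℝ) ≤ K * (C ^ 2 * (m : ℝ) ^ 2 / ε ^ 2) *
          Real.log (2 + C * (m : ℝ) / ε) ^ 6 * Real.log (2 / δ) ∧
        -- every circuit: constant depth, width, number of controlled swaps
        ∀ i, ((A.circuit i).depth : ℝ) ≤ K ∧
          (((A.circuit i).ancillas + (A.circuit i).registers : ℕ) : ℝ) ≤
            K * (effectiveRank r m (ε / (2 * C)) : ℝ) ∧
          ((A.circuit i).numCSwap : ℝ) ≤ K * (effectiveRank r m (ε / (2 * C)) : ℝ) := by
  -- The `10 q` powers use at most `10 q` copies in each of `N` runs, which turns `10 ^ 10` into `10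
  -- ^ 12`; the polylogarithmic bound adds a factor `64`.
  refine ⟨10 ^ 14, fun d r m ε δ C g c hε hδ hδ1 hg hc => ?_⟩
  have hC : 0 < C := (Finset.sum_nonneg fun _ _ => abs_nonneg _).trans_lt hc
  have hD : 0 ≤ Real.log (2 / δ) := Real.log_nonneg (by rw [le_div_iff₀ hδ]; linarith)
  have hlog6 : 0 ≤ Real.log (2 + C * (m : ℝ) / ε) ^ 6 := Even.pow_nonneg (by decide) _
  rcases Nat.lt_or_ge (effectiveRank r m (ε / (2 * C))) 2 with hq | hq
  · obtain ⟨v, hv⟩ := exists_constant_estimate (d := d) hε hg hc (Nat.lt_succ_iff.1 hq)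
    have h0 : (constProcedure v).copies = 0 := Finset.sum_of_isEmpty (ι := Fin 0) _
    have h1 : (constProcedure v).runs = 0 := rfl
    refine ⟨constProcedure v, fun ρ hρ hr => ?_, ?_, ?_, ?_, ?_, fun i => i.elim0⟩
    · obtain ⟨l, hl, hcfc, -⟩ := hρ.exists_isSpectrum hr
      rw [hcfc, constProcedure_successProb ρ (hv l hl)]
      linarith
    · rw [h0, Nat.cast_zero]; positivity
    · rw [h0, Nat.cast_zero]; positivity
    · rw [h1, Nat.cast_zero]; positivity
    · rw [h1, Nat.cast_zero]; positivity
  · have key := exists_procedure_of_two_le (d := d) hε hδ hδ1 hg hc hq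
    set q := effectiveRank r m (ε / (2 * C))
    obtain ⟨N, est, hN, hqlog, hsucc⟩ := key
    have hq' : (2 : ℝ) ≤ q := by exact_mod_cast hq
    set A := cycleProcedure (10 * q) N est with hA
    have hruns : (A.runs : ℝ) = 10 * q * N := by
      rw [show A.runs = 10 * q * N from rfl]; push_cast; rfl
    have hcopies : (A.copies : ℝ) ≤ 100 * q ^ 2 * N := by
      have h : (A.copies : ℝ) ≤ ((10 * q * N * (10 * q) : ℕ) : ℝ) := by
        exact_mod_cast cycleProcedure_copies_le (10 * q) N est
      push_cast at h
      linarith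
    have hy : 0 < C * m / ε := by
      by_contra h
      have h0 : C * m / ε = 0 := le_antisymm (not_lt.1 h) (by positivity)
      rw [h0, mul_zero, Real.log_zero] at hqlog
      linarith
    have hpoly := effectiveRank_pow_mul_log_sq_le (by omega) hy hqlog
    set Q := C ^ 2 * (m : ℝ) ^ 2 / ε ^ 2 with hQ
    have hQ0 : 0 ≤ Q := by positivity
    set D := Real.log (2 / δ)
    have e : ∀ p : ℕ, C ^ 2 * (m : ℝ) ^ 2 * (q : ℝ) ^ p * Real.log q ^ 2 / ε ^ 2
        = Q * ((q : ℝ) ^ p * Real.log q ^ 2) := fun p => by rw [hQ]; ring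
    rw [e] at hN ⊢
    rw [e]
    have b4 : 100 * (q : ℝ) ^ 2 * N ≤ 10 ^ 12 * (Q * ((q : ℝ) ^ 4 * Real.log q ^ 2)) * D := by
      refine (mul_le_mul_of_nonneg_left hN (by positivity)).trans_eq ?_
      ring
    have b3 : 10 * (q : ℝ) * N ≤ 10 ^ 11 * (Q * ((q : ℝ) ^ 3 * Real.log q ^ 2)) * D := by
      refine (mul_le_mul_of_nonneg_left hN (by positivity)).trans_eq ?_
      ring
    have b6 : 10 ^ 12 * (Q * ((q : ℝ) ^ 4 * Real.log q ^ 2)) * D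
        ≤ 10 ^ 14 * Q * Real.log (2 + C * (m : ℝ) / ε) ^ 6 * D := by
      refine mul_le_mul_of_nonneg_right ?_ hD
      have h1 := mul_le_mul_of_nonneg_left hpoly hQ0
      have h2 := mul_nonneg hQ0 hlog6
      linarith
    have b43 : 10 * (q : ℝ) * N ≤ 100 * (q : ℝ) ^ 2 * N := by
      refine mul_le_mul_of_nonneg_right ?_ (Nat.cast_nonneg N)
      nlinarith
    have mono : ∀ p : ℕ, ∀ a : ℝ, a ≤ 10 ^ 14 →
        a * (Q * ((q : ℝ) ^ p * Real.log q ^ 2)) * D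
          ≤ 10 ^ 14 * (Q * ((q : ℝ) ^ p * Real.log q ^ 2)) * D := fun p a ha => by
      gcongr
    refine ⟨A, hsucc, ?_, ?_, ?_, ?_, fun i => ?_⟩
    · exact (hcopies.trans b4).trans (mono 4 _ (by norm_num))
    · exact (hcopies.trans b4).trans b6
    · rw [hruns]
      exact b3.trans (mono 3 _ (by norm_num))
    · rw [hruns]
      exact (b43.trans b4).trans b6
    · set t := (finProdFinEquiv.symm (show Fin (10 * q * N) from i)).1 with ht
      have hi : A.circuit i = cycleTest t := rfl
      have htq : t.val + 1 ≤ 10 * q := t.isLt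
      rw [hi]
      refine ⟨?_, ?_, ?_⟩
      · rw [show (cycleTest t).depth = 5 from rfl]
        norm_num
      · rw [show (cycleTest t).ancillas + (cycleTest t).registers
          = (t.val + 1) + (t.val + 1) + (t.val + 1) from rfl]
        have : (((t.val + 1) + (t.val + 1) + (t.val + 1) : ℕ) : ℝ) ≤ ((30 * q : ℕ) : ℝ) := by
          exact_mod_cast (by omega)
        push_cast at this ⊢
        linarith
      · have h1 := cycleTest_numCSwap_le t
        have : ((cycleTest t).numCSwap : ℝ) ≤ ((60 * q : ℕ) : ℝ) := by
          exact_mod_cast (by omega)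
        push_cast at this
        linarith
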